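/- Regard a finite graph $G$ as a topological space in the usual way. A generic immersion of $G$ into the plane is a continuous map $f:G\to\mathbb{R}^2$ whose multiple points are only finitely many transversal double points of interior points of edges; these points of the plane are called the crossing points of $f$. Here transversal is meant topologically: near the point there are local coordinates of the plane (given by a homeomorphism between open sets) in which the two branches of $f$ through the point are the two coordinate axes. For a generic immersion $f$ let $$d(f)=\sum_{\{x,y\}}\#\bigl(f(x)\cap f(y)\bigr),$$ where the sum runs over all unordered pairs $\{x,y\}$ of mutually disjoint edges of $G$ (edges without a common vertex), and $\#(f(x)\cap f(y))$ is the number of crossing points of $f$ contained in $f(x)\cap f(y)$. Proposition. Let $G$ be the complete graph $K_5$ or the complete bipartite graph $K_{3,3}$, and let $f:G\to\mathbb{R}^2$ be a generic immersion. Then $d(f)\equiv 1\pmod 2$. -/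

import Mathlib

namespace PlaneGraph

/-- The Euclidean plane. -/
abbrev Plane : Type := EuclideanSpace ℝ (Fin 2)

variable {V : Type*} [Fintype V]

/-- The points of the standard simplex (with vertex set `V`) that lie on the closed edge `e`. -/
def closedEdge (e : Sym2 V) : Set (V → ℝ) :=
  {x | x ∈ stdSimplex ℝ V ∧ ∀ w, w ∉ e → x w = 0}

/-- The points of the closed edge `e` that are not endpoints of it. -/
def openEdge (e : Sym2 V) : Set (V → ℝ) :=
  {x | x ∈ closedEdge e ∧ ∀ w, w ∈ e → 0 < x w}

/-- The finite simple graph `G` as a topological space: the union of all the vertices of the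
standard simplex with vertex set `V` and of those edges of this simplex which are edges
of `G`, as a subspace of `V → ℝ`. -/
def realization (G : SimpleGraph V) : Set (V → ℝ) :=
  {x | x ∈ stdSimplex ℝ V ∧ ∃ v : V, ∀ w, w ≠ v → x w = 0} ∪ ⋃ e ∈ G.edgeSet, closedEdge e

/-- The map `f` passes transversally through the point `f a = f b` at `a` and `b`: in some local
(topological) coordinate system of the plane, centred at that point, the image under `f` of a
neighbourhood of `a` is the horizontal axis and that of a neighbourhood of `b` is the
vertical axis. -/
def CrossesTransversally {X : Type*} [TopologicalSpace X] (f : X → Plane) (a b : X) : Prop :=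
  ∃ h : OpenPartialHomeomorph Plane (ℝ × ℝ),
    (f a ∈ h.source ∧ h (f a) = 0) ∧ (f b ∈ h.source ∧ h (f b) = 0) ∧
    (∃ A ∈ nhds a, f '' A = {q | q ∈ h.source ∧ (h q).2 = 0}) ∧
    (∃ B ∈ nhds b, f '' B = {q | q ∈ h.source ∧ (h q).1 = 0})

/-- The multiple points of `f` (in the plane). -/
def crossingPoints {X : Type*} (f : X → Plane) : Set Plane :=
  {p | ∃ a b, a ≠ b ∧ f a = p ∧ f b = p}

/-- A generic immersion of `G` into the plane: a continuous map whose multiple points are only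
finitely many transversal double points of interior points of edges. -/
structure IsGenericImmersion (G : SimpleGraph V) (f : realization G → Plane) : Prop where
  continuous : Continuous f
  finite : (crossingPoints f).Finite
  double : ∀ a b c, f a = f b → f b = f c → a = b ∨ b = c ∨ a = c
  interior : ∀ a b, a ≠ b → f a = f b → ∃ e ∈ G.edgeSet, (a : V → ℝ) ∈ openEdge e
  transversal : ∀ a b, a ≠ b → f a = f b → CrossesTransversally f a b

/-- The image `f(e)` of the closed edge `e`. -/
def edgeImage {G : SimpleGraph V} (f : realization G → Plane) (e : Sym2 V) : Set Plane :=
  f '' {a | (a : V → ℝ) ∈ closedEdge e}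

/-- The unordered pairs of mutually disjoint edges of `G`. -/
noncomputable def disjointEdgePairs (G : SimpleGraph V) : Finset (Sym2 (Sym2 V)) :=
  (Set.toFinite {z : Sym2 (Sym2 V) | ∃ x ∈ G.edgeSet, ∃ y ∈ G.edgeSet,
    (∀ v, v ∈ x → v ∉ y) ∧ z = s(x, y)}).toFinset

/-- The number `d(f)`: the sum, over all unordered pairs `{x, y}` of disjoint edges, of the number
of crossing points of `f` contained in `f(x) ∩ f(y)`. -/
noncomputable def d {G : SimpleGraph V} (f : realization G → Plane) : ℕ :=
  ∑ z ∈ disjointEdgePairs G, (crossingPoints f ∩ ⋂ e ∈ z, edgeImage f e).ncard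

end PlaneGraph

namespace PlaneGraph
open Set Topology

/-! Parametrize two disjoint edges $vw$ and $v'w'$ by $\gamma_1,\gamma_2$ on $[0,1]$ and consider
$F(s,t)=\gamma_1(s)-\gamma_2(t)$ as a complex function on the square. Its zeros are exactly the
crossings of the two edges. Each has odd local winding number, so the number of crossings has the
parity of the winding number of $F$ along the boundary of the square
(`windingChange_disjoint_edges`).

On each side of the square one of the two points is a fixed vertex. After a choice of logarithms of
all differences of vertex images, the change of argument of an edge $vw$ seen from a vertex $u$ is a
term depending only on the vertices plus $2\pi i\,n(u,vw)$. So the crossing number of the pair is,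
modulo two, the sum of four integers $n(u,vw)$ and of a number determined by the order of the four
vertices, the same as for chords of a convex polygon (`ncard_crossings_parity`).

Now sum over all pairs of disjoint edges. The integer $n(u,vw)$ occurs once for each edge at $u$
disjoint from $vw$. In $K_5$ and in $K_{3,3}$ there are two such edges, so these integers cancel
modulo two (`d_parity`). What remains is the crossing count of the chord drawing: 5 for $K_5$ and 9
for $K_{3,3}$, both odd.

The oddness of a topological crossing is obtained without local degree theory: in the chart, the
difference map is deformed, without zeros on the boundary of a small square, to a map odd about the
centre (`isLocallyOdd_of_chart`), and an odd map has odd winding number (`windingChange_of_odd`). -/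

/-! ### Continuous logarithms along intervals. -/

/-- A nonvanishing continuous function on a retract of a real topological vector space has a
continuous logarithm. -/
theorem exists_log_of_retraction {E : Type*} [NormedAddCommGroup E] [NormedSpace ℝ E]
    {S : Set E} {r : E → E} (hr : Continuous r) (hrS : ∀ x, r x ∈ S) (hid : ∀ x ∈ S, r x = x)
    {F : E → ℂ} (hF : ContinuousOn F S) (h0 : ∀ x ∈ S, F x ≠ 0) :
    ∃ l : E → ℂ, ContinuousOn l S ∧ ∀ x ∈ S, Complex.exp (l x) = F x := by
  have hsc : IsSimplyConnected (univ : Set E) :=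
    (Homeomorph.Set.univ E).toHomotopyEquiv.simplyConnectedSpace
  obtain ⟨l, hl, hexp⟩ := Complex.exists_continuousOn_eqOn_exp_comp (g := F ∘ r)
    hsc isOpen_univ ((hF.comp_continuous hr hrS).continuousOn)
    (by rintro ⟨x, -, hx⟩; exact h0 _ (hrS x) hx)
  refine ⟨l, hl.mono (subset_univ _), fun x hx => ?_⟩
  have := hexp (mem_univ x)
  simpa [hid x hx] using this

/-- The clamping retraction of the line onto `[a, b]`. -/
theorem exists_retraction_Icc {a b : ℝ} (hab : a ≤ b) :
    ∃ r : ℝ → ℝ, Continuous r ∧ (∀ x, r x ∈ Icc a b) ∧ ∀ x ∈ Icc a b, r x = x :=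
  ⟨fun x => projIcc a b hab x, by fun_prop, fun x => (projIcc a b hab x).2,
    fun x hx => congrArg Subtype.val (projIcc_of_mem hab hx)⟩

theorem exists_log_Icc {c : ℝ → ℂ} {a b : ℝ} (hab : a ≤ b) (hc : ContinuousOn c (Icc a b))
    (h0 : ∀ t ∈ Icc a b, c t ≠ 0) :
    ∃ l : ℝ → ℂ, ContinuousOn l (Icc a b) ∧ ∀ t ∈ Icc a b, Complex.exp (l t) = c t := by
  obtain ⟨r, h1, h2, h3⟩ := exists_retraction_Icc hab
  exact exists_log_of_retraction h1 h2 h3 hc h0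

theorem exists_log_rectangle {F : ℝ × ℝ → ℂ} {a b c d : ℝ} (hab : a ≤ b) (hcd : c ≤ d)
    (hF : ContinuousOn F (Icc a b ×ˢ Icc c d)) (h0 : ∀ p ∈ Icc a b ×ˢ Icc c d, F p ≠ 0) :
    ∃ l : ℝ × ℝ → ℂ, ContinuousOn l (Icc a b ×ˢ Icc c d) ∧
      ∀ p ∈ Icc a b ×ˢ Icc c d, Complex.exp (l p) = F p := by
  obtain ⟨r, h1, h2, h3⟩ := exists_retraction_Icc hab
  obtain ⟨r', h1', h2', h3'⟩ := exists_retraction_Icc hcd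
  refine exists_log_of_retraction (r := fun p : ℝ × ℝ => (r p.1, r' p.2)) (by fun_prop)
    (fun p => mk_mem_prod (h2 _) (h2' _)) (fun p hp => ?_) hF h0
  exact Prod.ext (h3 _ hp.1) (h3' _ hp.2)

open Classical in
/-- The total change of a continuous logarithm of `c` along `[a, b]`
(zero if there is no such logarithm). -/
noncomputable def logChange (c : ℝ → ℂ) (a b : ℝ) : ℂ :=
  if h : ∃ l : ℝ → ℂ, ContinuousOn l (Icc a b) ∧ ∀ t ∈ Icc a b, Complex.exp (l t) = c t
  then h.choose b - h.choose a else 0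

/-- Two logarithms of `c` differ by a continuous function with values in the discrete kernel of
`exp`, which is constant on an interval. Hence any logarithm computes the change. -/
theorem logChange_eq {c l : ℝ → ℂ} {a b : ℝ} (hab : a ≤ b) (hl : ContinuousOn l (Icc a b))
    (hexp : ∀ t ∈ Icc a b, Complex.exp (l t) = c t) : logChange c a b = l b - l a := by
  have h : ∃ l : ℝ → ℂ, ContinuousOn l (Icc a b) ∧ ∀ t ∈ Icc a b, Complex.exp (l t) = c t :=
    ⟨l, hl, hexp⟩
  rw [logChange, dif_pos h]
  obtain ⟨h1, h2⟩ := h.choose_spec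
  have key : h.choose b - l b = h.choose a - l a := by
    refine Complex.isCoveringMap_exp.constOn_of_comp (s := Icc a b)
      (g := fun t => h.choose t - l t) isPreconnected_Icc (h1.sub hl) (fun t ht t' ht' => ?_)
      (right_mem_Icc.2 hab) (left_mem_Icc.2 hab)
    have ne : ∀ t ∈ Icc a b, c t ≠ 0 := fun t ht => hexp t ht ▸ Complex.exp_ne_zero _
    apply Subtype.ext
    simp only [Complex.exp_sub, h2 t ht, h2 t' ht', hexp t ht, hexp t' ht', div_self (ne t ht),
      div_self (ne t' ht')]
  linear_combination key

theorem logChange_congr {c c' : ℝ → ℂ} {a b : ℝ} (h : EqOn c c' (Icc a b)) :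
    logChange c a b = logChange c' a b := by
  have : (fun l : ℝ → ℂ => ContinuousOn l (Icc a b) ∧ ∀ t ∈ Icc a b, Complex.exp (l t) = c t) =
      fun l => ContinuousOn l (Icc a b) ∧ ∀ t ∈ Icc a b, Complex.exp (l t) = c' t :=
    funext fun l => propext (and_congr_right fun _ => forall₂_congr fun t ht => by rw [h ht])
  unfold logChange
  rw [this]

theorem logChange_add {c : ℝ → ℂ} {a m b : ℝ} (ham : a ≤ m) (hmb : m ≤ b)
    (hc : ContinuousOn c (Icc a b)) (h0 : ∀ t ∈ Icc a b, c t ≠ 0) :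
    logChange c a b = logChange c a m + logChange c m b := by
  obtain ⟨l, hl, hexp⟩ := exists_log_Icc (ham.trans hmb) hc h0
  have h1 : Icc a m ⊆ Icc a b := Icc_subset_Icc_right hmb
  have h2 : Icc m b ⊆ Icc a b := Icc_subset_Icc_left ham
  rw [logChange_eq (ham.trans hmb) hl hexp,
    logChange_eq ham (hl.mono h1) fun t ht => hexp t (h1 ht),
    logChange_eq hmb (hl.mono h2) fun t ht => hexp t (h2 ht)]
  ring

theorem exp_logChange {c : ℝ → ℂ} {a b : ℝ} (hab : a ≤ b)
    (hc : ContinuousOn c (Icc a b)) (h0 : ∀ t ∈ Icc a b, c t ≠ 0) :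
    Complex.exp (logChange c a b) = c b / c a := by
  obtain ⟨l, hl, hexp⟩ := exists_log_Icc hab hc h0
  rw [logChange_eq hab hl hexp, Complex.exp_sub, hexp _ (right_mem_Icc.2 hab),
    hexp _ (left_mem_Icc.2 hab)]

theorem logChange_neg {c : ℝ → ℂ} {a b : ℝ} (hab : a ≤ b)
    (hc : ContinuousOn c (Icc a b)) (h0 : ∀ t ∈ Icc a b, c t ≠ 0) :
    logChange (fun t => -c t) a b = logChange c a b := by
  obtain ⟨l, hl, hexp⟩ := exists_log_Icc hab hc h0
  rw [logChange_eq hab hl hexp,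
    logChange_eq (l := fun t => l t + Real.pi * Complex.I) hab (hl.add continuousOn_const)
      fun t ht => by rw [Complex.exp_add, Complex.exp_pi_mul_I, hexp t ht]; ring]
  ring

theorem logChange_reflect {c : ℝ → ℂ} {a b : ℝ} (hab : a ≤ b)
    (hc : ContinuousOn c (Icc a b)) (h0 : ∀ t ∈ Icc a b, c t ≠ 0) :
    logChange (fun t => c (a + b - t)) a b = -logChange c a b := by
  obtain ⟨l, hl, hexp⟩ := exists_log_Icc hab hc h0
  have hm : MapsTo (fun t => a + b - t) (Icc a b) (Icc a b) := fun t ht =>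
    ⟨by linarith [ht.2], by linarith [ht.1]⟩
  rw [logChange_eq hab hl hexp,
    logChange_eq (l := fun t => l (a + b - t)) hab (hl.comp (by fun_prop) hm)
      fun t ht => hexp _ (hm ht)]
  simp

/-! ### Winding numbers along the boundary of a rectangle. -/

/-- The change of a continuous logarithm of `F` along the boundary of `[a, b] × [c, d]`, which is
`2πi` times the winding number. -/
noncomputable def windingChange (F : ℝ → ℝ → ℂ) (a b c d : ℝ) : ℂ :=
  logChange (fun s => F s c) a b + logChange (fun t => F b t) c d
    - logChange (fun s => F s d) a b - logChange (fun t => F a t) c d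

/-- Without zeros there is a single logarithm on the whole rectangle, and its differences along the
four sides telescope. -/
theorem windingChange_eq_zero {F : ℝ → ℝ → ℂ} {a b c d : ℝ} (hab : a ≤ b) (hcd : c ≤ d)
    (hF : ContinuousOn (Function.uncurry F) (Icc a b ×ˢ Icc c d))
    (h0 : ∀ s ∈ Icc a b, ∀ t ∈ Icc c d, F s t ≠ 0) : windingChange F a b c d = 0 := by
  obtain ⟨l, hl, hexp⟩ := exists_log_rectangle hab hcd hF fun p hp => h0 _ hp.1 _ hp.2
  have horizontal : ∀ t ∈ Icc c d, logChange (fun s => F s t) a b = l (b, t) - l (a, t) :=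
    fun t ht => logChange_eq (l := fun s => l (s, t)) hab
      (hl.comp (by fun_prop) fun s hs => ⟨hs, ht⟩) fun s hs => hexp (s, t) ⟨hs, ht⟩
  have vertical : ∀ s ∈ Icc a b, logChange (fun t => F s t) c d = l (s, d) - l (s, c) :=
    fun s hs => logChange_eq (l := fun t => l (s, t)) hcd
      (hl.comp (by fun_prop) fun t ht => ⟨hs, ht⟩) fun t ht => hexp (s, t) ⟨hs, ht⟩
  rw [windingChange, horizontal c (left_mem_Icc.2 hcd), horizontal d (right_mem_Icc.2 hcd),
    vertical a (left_mem_Icc.2 hab), vertical b (right_mem_Icc.2 hab)]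
  ring

theorem windingChange_split_fst {F : ℝ → ℝ → ℂ} {a m b c d : ℝ} (ham : a ≤ m) (hmb : m ≤ b)
    (hF : Continuous (Function.uncurry F)) (hc : ∀ s ∈ Icc a b, F s c ≠ 0)
    (hd : ∀ s ∈ Icc a b, F s d ≠ 0) :
    windingChange F a b c d = windingChange F a m c d + windingChange F m b c d := by
  have cont : ∀ t, ContinuousOn (fun s => F s t) (Icc a b) := fun t =>
    (hF.comp (Continuous.prodMk_left t)).continuousOn
  simp only [windingChange]
  rw [logChange_add ham hmb (cont c) hc, logChange_add ham hmb (cont d) hd]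
  ring

theorem windingChange_split_snd {F : ℝ → ℝ → ℂ} {a b c m d : ℝ} (hcm : c ≤ m) (hmd : m ≤ d)
    (hF : Continuous (Function.uncurry F)) (ha : ∀ t ∈ Icc c d, F a t ≠ 0)
    (hb : ∀ t ∈ Icc c d, F b t ≠ 0) :
    windingChange F a b c d = windingChange F a b c m + windingChange F a b m d := by
  have cont : ∀ s, ContinuousOn (fun t => F s t) (Icc c d) := fun s =>
    (hF.comp (Continuous.prodMk_right s)).continuousOn
  simp only [windingChange]
  rw [logChange_add hcm hmd (cont a) ha, logChange_add hcm hmd (cont b) hb]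
  ring

/-- Homotopy invariance of the winding number. -/
theorem windingChange_homotopy {K : ℝ → ℝ → ℝ → ℂ} {a b c d : ℝ} (hab : a ≤ b) (hcd : c ≤ d)
    (hK : ContinuousOn (fun p : ℝ × ℝ × ℝ => K p.1 p.2.1 p.2.2)
      (Icc 0 1 ×ˢ Icc a b ×ˢ Icc c d))
    (h0 : ∀ τ ∈ Icc (0 : ℝ) 1, ∀ s ∈ Icc a b, ∀ t ∈ Icc c d,
      (s = a ∨ s = b ∨ t = c ∨ t = d) → K τ s t ≠ 0) :
    windingChange (K 0) a b c d = windingChange (K 1) a b c d := by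
  -- Over each side of the rectangle the homotopy has no zeros, so the winding around each of these
  -- four lateral faces vanishes. Their combination compares the two ends.
  have horizontal : ∀ t ∈ Icc c d, (t = c ∨ t = d) →
      windingChange (fun τ s => K τ s t) 0 1 a b = 0 := fun t ht h =>
    windingChange_eq_zero zero_le_one hab
      (hK.comp (f := fun p : ℝ × ℝ => (p.1, p.2, t)) (by fun_prop) fun p hp => ⟨hp.1, hp.2, ht⟩)
      fun τ hτ s hs => h0 τ hτ s hs t ht (by tauto)
  have vertical : ∀ s ∈ Icc a b, (s = a ∨ s = b) →
      windingChange (fun τ t => K τ s t) 0 1 c d = 0 := fun s hs h =>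
    windingChange_eq_zero zero_le_one hcd
      (hK.comp (f := fun p : ℝ × ℝ => (p.1, s, p.2)) (by fun_prop) fun p hp => ⟨hp.1, hs, hp.2⟩)
      fun τ hτ t ht => h0 τ hτ s hs t ht (by tauto)
  have h1 := horizontal c (left_mem_Icc.2 hcd) (.inl rfl)
  have h2 := horizontal d (right_mem_Icc.2 hcd) (.inr rfl)
  have h3 := vertical a (left_mem_Icc.2 hab) (.inl rfl)
  have h4 := vertical b (right_mem_Icc.2 hab) (.inr rfl)
  simp only [windingChange] at h1 h2 h3 h4 ⊢
  linear_combination h2 + h3 - h1 - h4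

/-- A function that is odd about the centre of a rectangle has odd winding number. -/
theorem windingChange_of_odd {F : ℝ → ℝ → ℂ} {a b c d : ℝ} (hab : a ≤ b) (hcd : c ≤ d)
    (hF : ContinuousOn (Function.uncurry F) (Icc a b ×ˢ Icc c d))
    (h0 : ∀ s ∈ Icc a b, ∀ t ∈ Icc c d, (s = a ∨ s = b ∨ t = c ∨ t = d) → F s t ≠ 0)
    (hodd : ∀ s ∈ Icc a b, ∀ t ∈ Icc c d, F (a + b - s) (c + d - t) = -F s t) :
    ∃ k : ℤ, windingChange F a b c d = 2 * Real.pi * Complex.I * (2 * k + 1) := by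
  have hc := left_mem_Icc.2 hcd
  have hb := right_mem_Icc.2 hab
  have hd := right_mem_Icc.2 hcd
  have ha := left_mem_Icc.2 hab
  have bottom_cont : ContinuousOn (fun s => F s c) (Icc a b) :=
    hF.comp (f := fun s => (s, c)) (by fun_prop) fun s hs => ⟨hs, hc⟩
  have bottom_ne : ∀ s ∈ Icc a b, F s c ≠ 0 := fun s hs => h0 s hs c hc (by tauto)
  have right_cont : ContinuousOn (fun t => F b t) (Icc c d) :=
    hF.comp (f := fun t => (b, t)) (by fun_prop) fun t ht => ⟨hb, ht⟩
  have right_ne : ∀ t ∈ Icc c d, F b t ≠ 0 := fun t ht => h0 b hb t ht (by tauto)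
  have hms : ∀ s ∈ Icc a b, a + b - s ∈ Icc a b := fun s hs =>
    ⟨by linarith [hs.2], by linarith [hs.1]⟩
  have hmt : ∀ t ∈ Icc c d, c + d - t ∈ Icc c d := fun t ht =>
    ⟨by linarith [ht.2], by linarith [ht.1]⟩
  -- Point reflection reverses the opposite side and negates the function. The reversal changes the
  -- sign and the negation changes nothing, so opposite sides contribute equally to the oriented
  -- boundary.
  have top : logChange (fun s => F s d) a b = -logChange (fun s => F s c) a b := by
    rw [← logChange_reflect hab bottom_cont bottom_ne, ← logChange_neg (c := fun s => F (a + b - s) c) hab]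
    · exact logChange_congr fun s hs => by
        simpa using hodd (a + b - s) (hms s hs) c hc
    · exact bottom_cont.comp (by fun_prop) hms
    · exact fun s hs => bottom_ne _ (hms s hs)
  have left : logChange (fun t => F a t) c d = -logChange (fun t => F b t) c d := by
    rw [← logChange_reflect hcd right_cont right_ne, ← logChange_neg (c := fun t => F b (c + d - t)) hcd]
    · exact logChange_congr fun t ht => by
        simpa using hodd b hb (c + d - t) (hmt t ht)
    · exact right_cont.comp (by fun_prop) hmt
    · exact fun t ht => right_ne _ (hmt t ht)
  -- Half of the boundary leads from $F(a,c)$ to $F(b,d)=-F(a,c)$, so its change is an odd multiple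
  -- of $\pi i$. The full boundary doubles it.
  have hexp : Complex.exp (logChange (fun s => F s c) a b + logChange (fun t => F b t) c d)
      = Complex.exp (Real.pi * Complex.I) := by
    have h := hodd a ha c hc
    simp only [add_sub_cancel_left] at h
    have h1 := bottom_ne a ha
    have h2 := bottom_ne b hb
    rw [Complex.exp_add, exp_logChange hab bottom_cont bottom_ne,
      exp_logChange hcd right_cont right_ne, Complex.exp_pi_mul_I, h]
    field_simp
  obtain ⟨k, hk⟩ := Complex.exp_eq_exp_iff_exists_int.1 hexp
  refine ⟨k, ?_⟩
  rw [windingChange, top, left]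
  linear_combination 2 * hk

/-! ### Counting zeros modulo two. -/

/-- The winding number of `F` is odd along arbitrarily small squares centred at `p`. -/
def IsLocallyOdd (F : ℝ → ℝ → ℂ) (p : ℝ × ℝ) : Prop :=
  ∀ ε > 0, ∃ δ > 0, δ < ε ∧ ∃ k : ℤ,
    windingChange F (p.1 - δ) (p.1 + δ) (p.2 - δ) (p.2 + δ) =
      2 * Real.pi * Complex.I * (2 * k + 1)

/-- Four cuts isolate a small square around the zero. The four rectangles cut off contain no zero
and contribute nothing. -/
theorem windingChange_of_unique_zero {F : ℝ → ℝ → ℂ} {a b c d : ℝ}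
    (hF : Continuous (Function.uncurry F)) {p : ℝ × ℝ} (hp1 : p.1 ∈ Ioo a b) (hp2 : p.2 ∈ Ioo c d)
    (huniq : ∀ s ∈ Icc a b, ∀ t ∈ Icc c d, F s t = 0 → s = p.1 ∧ t = p.2)
    (hodd : IsLocallyOdd F p) :
    ∃ k : ℤ, windingChange F a b c d = 2 * Real.pi * Complex.I * (2 * k + 1) := by
  obtain ⟨ha, hb⟩ := hp1
  obtain ⟨hc, hd⟩ := hp2
  obtain ⟨δ, hδ, hlt, k, hk⟩ := hodd (min (min (p.1 - a) (b - p.1)) (min (p.2 - c) (d - p.2)))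
    (by simp [ha, hb, hc, hd])
  simp only [lt_min_iff] at hlt
  obtain ⟨⟨h1, h2⟩, h3, h4⟩ := hlt
  have zero : ∀ a' b' c' d', a ≤ a' → a' ≤ b' → b' ≤ b → c ≤ c' → c' ≤ d' → d' ≤ d →
      (b' < p.1 ∨ p.1 < a' ∨ d' < p.2 ∨ p.2 < c') → windingChange F a' b' c' d' = 0 := by
    intro a' b' c' d' h1 h2 h3 h4 h5 h6 h
    refine windingChange_eq_zero h2 h5 hF.continuousOn fun s hs t ht h0 => ?_
    obtain ⟨rfl, rfl⟩ := huniq s ⟨h1.trans hs.1, hs.2.trans h3⟩ t ⟨h4.trans ht.1, ht.2.trans h6⟩ h0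
    rcases h with h | h | h | h
    · exact absurd hs.2 (not_le.2 h)
    · exact absurd hs.1 (not_le.2 h)
    · exact absurd ht.2 (not_le.2 h)
    · exact absurd ht.1 (not_le.2 h)
  have ne : ∀ s ∈ Icc a b, ∀ t ∈ Icc c d, s ≠ p.1 ∨ t ≠ p.2 → F s t ≠ 0 := by
    intro s hs t ht h h0
    have := huniq s hs t ht h0
    tauto
  refine ⟨k, ?_⟩
  rw [windingChange_split_fst (m := p.1 - δ) (by linarith) (by linarith) hF
      (fun s hs => ne s hs c ⟨le_rfl, by linarith⟩ (.inr (by linarith)))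
      (fun s hs => ne s hs d ⟨by linarith, le_rfl⟩ (.inr (by linarith))),
    zero a (p.1 - δ) c d le_rfl (by linarith) (by linarith) le_rfl (by linarith) le_rfl
      (.inl (by linarith)),
    windingChange_split_fst (m := p.1 + δ) (by linarith) (by linarith) hF
      (fun s hs => ne s ⟨by linarith [hs.1], hs.2⟩ c ⟨le_rfl, by linarith⟩ (.inr (by linarith)))
      (fun s hs => ne s ⟨by linarith [hs.1], hs.2⟩ d ⟨by linarith, le_rfl⟩ (.inr (by linarith))),
    zero (p.1 + δ) b c d (by linarith) (by linarith) le_rfl le_rfl (by linarith) le_rfl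
      (.inr (.inl (by linarith))),
    windingChange_split_snd (m := p.2 - δ) (by linarith) (by linarith) hF
      (fun t ht => ne _ ⟨by linarith, by linarith⟩ t ht (.inl (by linarith)))
      (fun t ht => ne _ ⟨by linarith, by linarith⟩ t ht (.inl (by linarith))),
    zero (p.1 - δ) (p.1 + δ) c (p.2 - δ) (by linarith) (by linarith) (by linarith) le_rfl
      (by linarith) (by linarith) (.inr (.inr (.inl (by linarith)))),
    windingChange_split_snd (m := p.2 + δ) (by linarith) (by linarith) hF
      (fun t ht => ne _ ⟨by linarith, by linarith⟩ t ⟨by linarith [ht.1], ht.2⟩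
        (.inl (by linarith)))
      (fun t ht => ne _ ⟨by linarith, by linarith⟩ t ⟨by linarith [ht.1], ht.2⟩
        (.inl (by linarith))),
    zero (p.1 - δ) (p.1 + δ) (p.2 + δ) d (by linarith) (by linarith) (by linarith)
      (by linarith) (by linarith) le_rfl (.inr (.inr (.inr (by linarith)))), hk]
  ring

/-- The winding number has the parity of the number of zeros, if these are locally odd. -/
theorem windingChange_parity {F : ℝ → ℝ → ℂ} {c d : ℝ} (hcd : c ≤ d)
    (hF : Continuous (Function.uncurry F)) (n : ℕ) {a b : ℝ} (hab : a ≤ b)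
    {Z : Finset (ℝ × ℝ)} (hZ : ∀ p, p ∈ Z ↔ (p.1 ∈ Icc a b ∧ p.2 ∈ Icc c d) ∧ F p.1 p.2 = 0)
    (hint : ∀ p ∈ Z, p.1 ∈ Ioo a b ∧ p.2 ∈ Ioo c d)
    (hinj : ∀ p ∈ Z, ∀ q ∈ Z, p.1 = q.1 → p = q) (hodd : ∀ p ∈ Z, IsLocallyOdd F p)
    (hn : Z.card = n) :
    ∃ k : ℤ, windingChange F a b c d = 2 * Real.pi * Complex.I * (n + 2 * k) := by
  induction n using Nat.strong_induction_on generalizing a b Z with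
  | _ n ih =>
    rcases lt_trichotomy n 1 with h | h | h
    · obtain rfl : n = 0 := by omega
      obtain rfl := Finset.card_eq_zero.1 hn
      refine ⟨0, ?_⟩
      rw [windingChange_eq_zero hab hcd hF.continuousOn fun s hs t ht h0 => ?_]
      · simp
      · simpa using (hZ (s, t)).2 ⟨⟨hs, ht⟩, h0⟩
    · subst h
      obtain ⟨p, rfl⟩ := Finset.card_eq_one.1 hn
      obtain ⟨h1, h2⟩ := hint p (by simp)
      obtain ⟨k, hk⟩ := windingChange_of_unique_zero hF h1 h2 (fun s hs t ht h0 => by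
        have := (hZ (s, t)).2 ⟨⟨hs, ht⟩, h0⟩
        rw [Finset.mem_singleton] at this
        simp [← this]) (hodd p (by simp))
      exact ⟨k, by rw [hk]; push_cast; ring⟩
    · obtain ⟨p, hp, q, hq, hpq⟩ : ∃ p ∈ Z, ∃ q ∈ Z, p.1 < q.1 := by
        obtain ⟨p, hp, q, hq, hne⟩ := Finset.one_lt_card.1 (hn ▸ h)
        rcases lt_trichotomy p.1 q.1 with h | h | h
        · exact ⟨p, hp, q, hq, h⟩
        · exact absurd (hinj p hp q hq h) hne
        · exact ⟨q, hq, p, hp, h⟩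
      -- The vertical cut must miss every zero and have a zero on either side, so that both halves
      -- have strictly fewer zeros, all of them interior.
      obtain ⟨m, ⟨hpm, hmq⟩, hm⟩ :=
        ((Ioo_infinite hpq).sdiff (Z.image Prod.fst).finite_toSet).nonempty
      have hm' : ∀ r ∈ Z, r.1 ≠ m := fun r hr h =>
        hm (Finset.mem_coe.2 (Finset.mem_image.2 ⟨r, hr, h⟩))
      have ham : a < m := (hint p hp).1.1.trans hpm
      have hmb : m < b := hmq.trans (hint q hq).1.2
      have hcard := Finset.card_filter_add_card_filter_not (s := Z) (fun r => r.1 < m)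
      have hne : ∀ s ∈ Icc a b, F s c ≠ 0 ∧ F s d ≠ 0 := fun s hs =>
        ⟨fun h0 => (lt_irrefl c) (hint (s, c) ((hZ _).2 ⟨⟨hs, le_rfl, hcd⟩, h0⟩)).2.1,
          fun h0 => (lt_irrefl d) (hint (s, d) ((hZ _).2 ⟨⟨hs, hcd, le_rfl⟩, h0⟩)).2.2⟩
      have hlt1 : (Z.filter fun r => ¬ r.1 < m).card ≠ 0 :=
        Finset.card_ne_zero_of_mem (Finset.mem_filter.2 ⟨hq, not_lt.2 hmq.le⟩)
      have hlt2 : (Z.filter fun r => r.1 < m).card ≠ 0 :=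
        Finset.card_ne_zero_of_mem (Finset.mem_filter.2 ⟨hp, hpm⟩)
      obtain ⟨k1, hk1⟩ := ih (Z.filter fun r => r.1 < m).card (by omega) ham.le
        (Z := Z.filter fun r => r.1 < m) (fun r => by
          rw [Finset.mem_filter, hZ]
          constructor
          · rintro ⟨⟨⟨h1, h2⟩, h3⟩, h4⟩
            exact ⟨⟨⟨h1.1, h4.le⟩, h2⟩, h3⟩
          · rintro ⟨⟨h1, h2⟩, h3⟩
            have h4 : (r.1 ∈ Icc a b ∧ r.2 ∈ Icc c d) ∧ F r.1 r.2 = 0 :=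
              ⟨⟨⟨h1.1, h1.2.trans hmb.le⟩, h2⟩, h3⟩
            exact ⟨h4, lt_of_le_of_ne h1.2 (hm' r ((hZ r).2 h4))⟩)
        (fun r hr => by
          rw [Finset.mem_filter] at hr
          exact ⟨⟨(hint r hr.1).1.1, hr.2⟩, (hint r hr.1).2⟩)
        (fun r hr r' hr' => hinj r (Finset.mem_filter.1 hr).1 r' (Finset.mem_filter.1 hr').1)
        (fun r hr => hodd r (Finset.mem_filter.1 hr).1) rfl
      obtain ⟨k2, hk2⟩ := ih (Z.filter fun r => ¬ r.1 < m).card (by omega) hmb.le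
        (Z := Z.filter fun r => ¬ r.1 < m) (fun r => by
          rw [Finset.mem_filter, hZ]
          constructor
          · rintro ⟨⟨⟨h1, h2⟩, h3⟩, h4⟩
            exact ⟨⟨⟨not_lt.1 h4, h1.2⟩, h2⟩, h3⟩
          · rintro ⟨⟨h1, h2⟩, h3⟩
            exact ⟨⟨⟨⟨ham.le.trans h1.1, h1.2⟩, h2⟩, h3⟩, not_lt.2 h1.1⟩)
        (fun r hr => by
          rw [Finset.mem_filter] at hr
          exact ⟨⟨lt_of_le_of_ne (not_lt.1 hr.2) (hm' r hr.1).symm, (hint r hr.1).1.2⟩,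
            (hint r hr.1).2⟩)
        (fun r hr r' hr' => hinj r (Finset.mem_filter.1 hr).1 r' (Finset.mem_filter.1 hr').1)
        (fun r hr => hodd r (Finset.mem_filter.1 hr).1) rfl
      refine ⟨k1 + k2, ?_⟩
      rw [windingChange_split_fst ham.le hmb.le hF (fun s hs => (hne s hs).1)
        (fun s hs => (hne s hs).2), hk1, hk2, ← hn, ← hcard]
      push_cast
      ring


/-! ### Parametrized edges of the realization. -/

section EdgePath

variable {V : Type*} [Fintype V]

theorem isClosed_closedEdge (e : Sym2 V) : IsClosed (closedEdge e) := by
  have : closedEdge e = stdSimplex ℝ V ∩ ⋂ w, ⋂ _ : w ∉ e, {x : V → ℝ | x w = 0} := by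
    ext x
    simp [closedEdge]
  rw [this]
  exact (isClosed_stdSimplex ℝ V).inter (isClosed_iInter fun w => isClosed_iInter fun _ =>
    isClosed_eq (continuous_apply w) continuous_const)

/-- Compactness makes `f` a closed map, which controls the fibres over points near a crossing. -/
theorem isCompact_realization (G : SimpleGraph V) : IsCompact (realization G) := by
  refine (isCompact_stdSimplex ℝ V).of_isClosed_subset (IsClosed.union ?_ ?_) ?_
  · have : {x : V → ℝ | x ∈ stdSimplex ℝ V ∧ ∃ v : V, ∀ w, w ≠ v → x w = 0} =
        ⋃ v, closedEdge s(v, v) := by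
      ext x
      simp [closedEdge]
    rw [this]
    exact isClosed_iUnion_of_finite fun v => isClosed_closedEdge _
  · exact (toFinite _).isClosed_biUnion fun e _ => isClosed_closedEdge e
  · rintro x (hx | hx)
    · exact hx.1
    · simp only [mem_iUnion] at hx
      obtain ⟨e, -, he⟩ := hx
      exact he.1

instance (G : SimpleGraph V) : CompactSpace (realization G) :=
  isCompact_iff_compactSpace.1 (isCompact_realization G)

variable [DecidableEq V] {G : SimpleGraph V}

/-- The vertex `v` as a point of the realization. -/
def vertexPoint (G : SimpleGraph V) (v : V) : realization G :=
  ⟨Pi.single v 1, .inl ⟨single_mem_stdSimplex ℝ v, v, fun _ hw => Pi.single_eq_of_ne hw 1⟩⟩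

theorem segment_mem_closedEdge {v w : V} {s : ℝ} (hs : s ∈ Icc (0 : ℝ) 1) :
    (1 - s) • Pi.single v (1 : ℝ) + s • Pi.single w (1 : ℝ) ∈ closedEdge s(v, w) := by
  refine ⟨(convex_stdSimplex ℝ V) (single_mem_stdSimplex ℝ v) (single_mem_stdSimplex ℝ w)
    (by linarith [hs.2]) hs.1 (by ring), fun u hu => ?_⟩
  rw [Sym2.mem_iff, not_or] at hu
  simp [hu.1, hu.2]

/-- The affine parametrization of the edge from `v` to `w` by `[0, 1]`, extended to the line by
constants. -/
noncomputable def edgePath {v w : V} (h : G.Adj v w) (s : ℝ) : realization G :=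
  ⟨(1 - (projIcc 0 1 zero_le_one s : ℝ)) • Pi.single v (1 : ℝ) +
      (projIcc 0 1 zero_le_one s : ℝ) • Pi.single w (1 : ℝ),
    .inr (mem_biUnion (G.mem_edgeSet.2 h) (segment_mem_closedEdge (projIcc 0 1 zero_le_one s).2))⟩

theorem continuous_edgePath {v w : V} (h : G.Adj v w) : Continuous (edgePath h) := by
  unfold edgePath
  refine Continuous.subtype_mk ?_ _
  have : Continuous fun s : ℝ => (projIcc 0 1 zero_le_one s : ℝ) := by fun_prop
  exact ((continuous_const.sub this).smul continuous_const).add (this.smul continuous_const)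

theorem edgePath_val {v w : V} (h : G.Adj v w) {s : ℝ} (hs : s ∈ Icc (0 : ℝ) 1) :
    (edgePath h s : V → ℝ) = (1 - s) • Pi.single v (1 : ℝ) + s • Pi.single w (1 : ℝ) := by
  simp [edgePath, projIcc_of_mem zero_le_one hs]

theorem edgePath_left {v w : V} (h : G.Adj v w) {s : ℝ} (hs : s ∈ Icc (0 : ℝ) 1) :
    (edgePath h s : V → ℝ) v = 1 - s := by
  simp [edgePath_val h hs, h.ne]

theorem edgePath_right {v w : V} (h : G.Adj v w) {s : ℝ} (hs : s ∈ Icc (0 : ℝ) 1) :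
    (edgePath h s : V → ℝ) w = s := by
  simp [edgePath_val h hs, h.ne']

theorem edgePath_mem_closedEdge {v w : V} (h : G.Adj v w) (s : ℝ) :
    (edgePath h s : V → ℝ) ∈ closedEdge s(v, w) :=
  segment_mem_closedEdge (projIcc 0 1 zero_le_one s).2

theorem edgePath_zero {v w : V} (h : G.Adj v w) : edgePath h 0 = vertexPoint G v :=
  Subtype.ext (by simp [edgePath_val h (left_mem_Icc.2 zero_le_one), vertexPoint])

theorem edgePath_one {v w : V} (h : G.Adj v w) : edgePath h 1 = vertexPoint G w :=
  Subtype.ext (by simp [edgePath_val h (right_mem_Icc.2 zero_le_one), vertexPoint])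

theorem injOn_edgePath {v w : V} (h : G.Adj v w) : InjOn (edgePath h) (Icc 0 1) := by
  intro s hs t ht hst
  rw [← edgePath_right h hs, ← edgePath_right h ht, hst]

theorem mem_closedEdge_mk {v w : V} (hvw : v ≠ w) {x : V → ℝ} (hx : x ∈ closedEdge s(v, w)) :
    x w ∈ Icc (0 : ℝ) 1 ∧ x = (1 - x w) • Pi.single v (1 : ℝ) + x w • Pi.single w (1 : ℝ) := by
  obtain ⟨⟨hpos, hsum⟩, hzero⟩ := hx
  have hsum' : x v + x w = 1 := by
    rw [← hsum, ← Finset.sum_pair hvw]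
    refine Finset.sum_subset (Finset.subset_univ _) fun u _ hu => hzero u ?_
    simpa using hu
  refine ⟨⟨hpos w, by linarith [hpos v]⟩, funext fun u => ?_⟩
  by_cases h1 : u = v
  · subst h1
    simp [hvw]
    linarith
  · by_cases h2 : u = w
    · subst h2
      simp [hvw.symm]
    · simp [h1, h2, hzero u (by simp [h1, h2])]

theorem eq_edgePath_of_mem_closedEdge {v w : V} (h : G.Adj v w) {q : realization G}
    (hq : (q : V → ℝ) ∈ closedEdge s(v, w)) :
    (q : V → ℝ) w ∈ Icc (0 : ℝ) 1 ∧ q = edgePath h ((q : V → ℝ) w) := by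
  obtain ⟨h1, h2⟩ := mem_closedEdge_mk h.ne hq
  exact ⟨h1, Subtype.ext (by rw [edgePath_val h h1]; exact h2)⟩

/-- Positivity of two coordinates is an open condition, so this shows that a neighbourhood of an
interior point of an edge stays on that edge. -/
theorem eq_edgePath_of_pos {v w : V} (h : G.Adj v w) {q : realization G}
    (hv : 0 < (q : V → ℝ) v) (hw : 0 < (q : V → ℝ) w) :
    (q : V → ℝ) w ∈ Icc (0 : ℝ) 1 ∧ q = edgePath h ((q : V → ℝ) w) := by
  refine eq_edgePath_of_mem_closedEdge h ?_
  rcases q.2 with ⟨-, u, hu⟩ | hq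
  · by_cases h1 : v = u
    · exact absurd (hu w (h1 ▸ h.ne')) hw.ne'
    · exact absurd (hu v h1) hv.ne'
  · simp only [mem_iUnion] at hq
    obtain ⟨e, -, he⟩ := hq
    have hve : v ∈ e := by
      by_contra h1
      exact hv.ne' (he.2 v h1)
    have hwe : w ∈ e := by
      by_contra h1
      exact hw.ne' (he.2 w h1)
    rwa [← (Sym2.mem_and_mem_iff h.ne).1 ⟨hve, hwe⟩]

theorem closedEdge_disjoint {x y : Sym2 V} (hxy : ∀ v, v ∈ x → v ∉ y) {p : V → ℝ}
    (hp : p ∈ closedEdge x) : p ∉ closedEdge y := by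
  intro hp'
  have : ∀ v, p v = 0 := fun v => by
    by_cases h : v ∈ x
    · exact hp'.2 v (hxy v h)
    · exact hp.2 v h
  simpa [this] using hp.1.2

theorem vertexPoint_notMem_openEdge (v : V) {e : Sym2 V} (he : e ∈ G.edgeSet) :
    (vertexPoint G v : V → ℝ) ∉ openEdge e := by
  rintro ⟨-, h⟩
  induction e using Sym2.ind with
  | _ p q =>
    have hpq : p ≠ q := (G.mem_edgeSet.1 he).ne
    have key : ∀ u, u ∈ s(p, q) → u = v := fun u hu => by
      by_contra huv
      have := h u hu
      simp [vertexPoint, huv] at this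
    exact hpq ((key p (by simp)).trans (key q (by simp)).symm)

end EdgePath

/-! ### Change of sides at a transversal double point. -/

/-- A continuous nonvanishing function on a preconnected set of reals keeps its sign. -/
theorem pos_of_pos_of_ne_zero {S : Set ℝ} (hS : IsPreconnected S) {u : ℝ → ℝ}
    (hu : ContinuousOn u S) (h0 : ∀ s ∈ S, u s ≠ 0) {s t : ℝ} (hs : s ∈ S) (ht : t ∈ S)
    (hpos : 0 < u s) : 0 < u t := by
  by_contra hneg
  obtain ⟨r, hr, hr0⟩ := hS.intermediate_value ht hs hu ⟨not_lt.1 hneg, hpos.le⟩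
  exact h0 r hr hr0

/-- A function which is continuous near `s₀`, vanishes only at `s₀` and takes values of both signs
near `s₀` changes its sign there. -/
theorem exists_sign_change {u : ℝ → ℝ} {s₀ ε : ℝ} (hε : 0 < ε)
    (hu : ContinuousOn u (Ioo (s₀ - ε) (s₀ + ε))) (h0 : u s₀ = 0)
    (hne : ∀ s ∈ Ioo (s₀ - ε) (s₀ + ε), s ≠ s₀ → u s ≠ 0)
    (hpos : ∃ s ∈ Ioo (s₀ - ε) (s₀ + ε), 0 < u s)
    (hneg : ∃ s ∈ Ioo (s₀ - ε) (s₀ + ε), u s < 0) :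
    ∃ σ : ℝ, |σ| = 1 ∧ ∀ s ∈ Ioo (s₀ - ε) (s₀ + ε), s ≠ s₀ → 0 < σ * u s * (s - s₀) := by
  wlog hp : 0 < u (s₀ + ε / 2) generalizing u
  · have hm : u (s₀ + ε / 2) ≠ 0 :=
      hne _ ⟨by linarith, by linarith⟩ (by linarith)
    obtain ⟨σ, h1, h2⟩ := this (u := fun s => -u s) hu.neg (by simp [h0])
      (fun s hs h => neg_ne_zero.2 (hne s hs h)) (by simpa using hneg) (by simpa using hpos)
      (by simpa using lt_of_le_of_ne (not_lt.1 hp) hm)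
    refine ⟨-σ, by simpa using h1, fun s hs h => ?_⟩
    have := h2 s hs h
    linarith
  have hr : Ioo s₀ (s₀ + ε) ⊆ Ioo (s₀ - ε) (s₀ + ε) := Ioo_subset_Ioo_left (by linarith)
  have hl : Ioo (s₀ - ε) s₀ ⊆ Ioo (s₀ - ε) (s₀ + ε) := Ioo_subset_Ioo_right (by linarith)
  have right : ∀ s ∈ Ioo s₀ (s₀ + ε), 0 < u s := fun s hs =>
    pos_of_pos_of_ne_zero isPreconnected_Ioo (hu.mono hr)
      (fun t ht => hne t (hr ht) ht.1.ne') ⟨by linarith, by linarith⟩ hs hp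
  obtain ⟨s₁, hs₁, hlt⟩ := hneg
  have hs₁l : s₁ ∈ Ioo (s₀ - ε) s₀ := by
    refine ⟨hs₁.1, ?_⟩
    by_contra h
    rcases (not_lt.1 h).eq_or_lt with h | h
    · rw [← h, h0] at hlt
      exact lt_irrefl _ hlt
    · exact (right s₁ ⟨h, hs₁.2⟩).not_gt hlt
  have left : ∀ s ∈ Ioo (s₀ - ε) s₀, 0 < -u s := fun s hs =>
    pos_of_pos_of_ne_zero (u := fun s => -u s) isPreconnected_Ioo (hu.mono hl).neg
      (fun t ht => neg_ne_zero.2 (hne t (hl ht) ht.2.ne)) hs₁l hs (by linarith)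
  refine ⟨1, by simp, fun s hs h => ?_⟩
  rcases lt_or_gt_of_ne h with h | h
  · nlinarith [left s ⟨hs.1, h⟩]
  · nlinarith [right s ⟨h, hs.2⟩]

/-- At a transversal double point the branch along the horizontal axis passes from one side of the
vertical axis to the other. -/
theorem exists_branch_sign {V : Type*} [Fintype V] [DecidableEq V] {G : SimpleGraph V}
    {f : realization G → Plane} (hf : IsGenericImmersion G f) {v w : V} (hvw : G.Adj v w)
    {s₀ : ℝ} (hs₀ : s₀ ∈ Ioo (0 : ℝ) 1) {b : realization G} (hb : edgePath hvw s₀ ≠ b)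
    (hfb : f (edgePath hvw s₀) = f b) (h : OpenPartialHomeomorph Plane (ℝ × ℝ))
    (hsrc : f (edgePath hvw s₀) ∈ h.source) (hcenter : h (f (edgePath hvw s₀)) = 0)
    {A B : Set (realization G)} (hA : A ∈ 𝓝 (edgePath hvw s₀)) (hB : B ∈ 𝓝 b)
    (hfA : f '' A = {q | q ∈ h.source ∧ (h q).2 = 0})
    (hfB : f '' B = {q | q ∈ h.source ∧ (h q).1 = 0}) :
    ∃ σ : ℝ, |σ| = 1 ∧ ∃ ε > 0, ∀ s ∈ Ioo (s₀ - ε) (s₀ + ε),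
      f (edgePath hvw s) ∈ h.source ∧ (h (f (edgePath hvw s))).2 = 0 ∧
      (s ≠ s₀ → 0 < σ * (h (f (edgePath hvw s))).1 * (s - s₀)) := by
  have hcont : Continuous (edgePath hvw) := continuous_edgePath hvw
  have ev : ∀ᶠ s in 𝓝 s₀, s ∈ Ioo (0 : ℝ) 1 ∧ edgePath hvw s ∈ A ∧ edgePath hvw s ≠ b :=
    (Filter.eventually_mem_set.2 (Ioo_mem_nhds hs₀.1 hs₀.2)).and ((hcont.continuousAt.eventually hA).and
      (hcont.continuousAt.eventually (isOpen_ne.mem_nhds hb)))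
  obtain ⟨ε, hε, hball⟩ := Metric.eventually_nhds_iff_ball.1 ev
  rw [Real.ball_eq_Ioo] at hball
  have branch : ∀ s ∈ Ioo (s₀ - ε) (s₀ + ε),
      f (edgePath hvw s) ∈ h.source ∧ (h (f (edgePath hvw s))).2 = 0 := fun s hs => by
    have : f (edgePath hvw s) ∈ f '' A := mem_image_of_mem f (hball s hs).2.1
    rwa [hfA] at this
  have hucont : ContinuousOn (fun s => (h (f (edgePath hvw s))).1) (Ioo (s₀ - ε) (s₀ + ε)) :=
    continuous_fst.comp_continuousOn
      (h.continuousOn.comp (hf.continuous.comp hcont).continuousOn fun s hs => (branch s hs).1)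
  -- Another zero on the branch would be a third preimage of the crossing point.
  have hne : ∀ s ∈ Ioo (s₀ - ε) (s₀ + ε), s ≠ s₀ → (h (f (edgePath hvw s))).1 ≠ 0 := by
    intro s hs hss₀ hzero
    have heq : f (edgePath hvw s) = f (edgePath hvw s₀) :=
      h.injOn (branch s hs).1 hsrc (by rw [hcenter]; exact Prod.ext hzero (branch s hs).2)
    rcases hf.double (edgePath hvw s) (edgePath hvw s₀) b heq hfb with h1 | h1 | h1
    · exact hss₀ (injOn_edgePath hvw (Ioo_subset_Icc_self (hball s hs).1)
        (Ioo_subset_Icc_self hs₀) h1)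
    · exact hb h1
    · exact (hball s hs).2.2 h1
  -- The equality for `f '' A` does not say which part of `A` covers which half-axis. The point is
  -- to reach both halves from the edge arbitrarily near `s₀`; `ν` selects the half.
  have signs : ∀ ν : ℝ, ν ≠ 0 → ∃ s ∈ Ioo (s₀ - ε) (s₀ + ε),
      0 < ν * (h (f (edgePath hvw s))).1 := by
    intro ν hν
    have hN : ∀ᶠ q : realization G in 𝓝 (edgePath hvw s₀), 0 < (q : V → ℝ) v ∧ 0 < (q : V → ℝ) w ∧
        (q : V → ℝ) w ∈ Ioo (s₀ - ε) (s₀ + ε) := by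
      have c : ∀ u : V, Continuous fun q : realization G => (q : V → ℝ) u := fun u =>
        (continuous_apply u).comp continuous_subtype_val
      have hs := Ioo_subset_Icc_self hs₀
      refine ((c v).continuousAt.eventually_const_lt ?_).and
        (((c w).continuousAt.eventually_const_lt ?_).and
          ((c w).continuousAt.eventually (Ioo_mem_nhds ?_ ?_)))
      · simp only [edgePath_left hvw hs]; linarith [hs₀.2]
      · simp only [edgePath_right hvw hs]; exact hs₀.1
      · simp only [edgePath_right hvw hs]; linarith
      · simp only [edgePath_right hvw hs]; linarith
    -- The crossing point has only two preimages. As `f` is closed, every preimage of a nearby point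
    -- lies near `edgePath hvw s₀` on the edge, or in `B`.
    have fiber := hf.continuous.isClosedMap.eventually_nhds_fiber
      (p := fun q => (0 < (q : V → ℝ) v ∧ 0 < (q : V → ℝ) w ∧
        (q : V → ℝ) w ∈ Ioo (s₀ - ε) (s₀ + ε)) ∨ q ∈ B) (f (edgePath hvw s₀)) (by
      intro q hq
      rcases hf.double q (edgePath hvw s₀) b hq hfb with h1 | h1 | h1
      · rw [h1]; exact hN.mono fun _ => .inl
      · exact absurd h1 hb
      · rw [h1]; exact Filter.mem_of_superset hB fun _ => .inr)
    have htarget : (0 : ℝ × ℝ) ∈ h.target := hcenter ▸ h.map_source hsrc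
    have hsymm : h.symm 0 = f (edgePath hvw s₀) := by rw [← hcenter, h.left_inv hsrc]
    have htend : Filter.Tendsto (fun r : ℝ => ((ν * r, 0) : ℝ × ℝ)) (𝓝[>] 0) (𝓝 0) := by
      have : Continuous (fun r : ℝ => ((ν * r, 0) : ℝ × ℝ)) := by fun_prop
      simpa [Prod.zero_eq_mk] using (this.tendsto 0).mono_left (nhdsWithin_le_nhds (s := Ioi 0))
    have hcs : Filter.Tendsto h.symm (𝓝 0) (𝓝 (f (edgePath hvw s₀))) := by
      rw [← hsymm]
      exact h.symm.continuousAt htarget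
    obtain ⟨r, hr, hrt, hrf⟩ := ((Filter.eventually_mem_set.2 self_mem_nhdsWithin).and
      ((htend.eventually (h.open_target.mem_nhds htarget)).and
        (htend.eventually (hcs.eventually fiber)))).exists
    have hr' : (0 : ℝ) < r := hr
    have hmem : h.symm (ν * r, 0) ∈ f '' A := by
      rw [hfA]
      exact ⟨h.map_target hrt, by rw [h.right_inv hrt]⟩
    obtain ⟨q, -, hq⟩ := hmem
    rcases hrf q hq with ⟨h1, h2, h3⟩ | hqB
    · obtain ⟨-, h4⟩ := eq_edgePath_of_pos hvw h1 h2
      refine ⟨(q : V → ℝ) w, h3, ?_⟩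
      rw [← h4, hq, h.right_inv hrt]
      have := mul_self_pos.2 hν
      simp only
      nlinarith
    -- A preimage in `B` would put the test point on the vertical axis, although its first
    -- coordinate is $\nu r\ne 0$.
    · have : f q ∈ f '' B := mem_image_of_mem f hqB
      rw [hfB, hq] at this
      have h5 := this.2
      rw [h.right_inv hrt] at h5
      exact absurd h5 (mul_ne_zero hν hr'.ne')
  obtain ⟨σ, hσ, hsign⟩ := exists_sign_change hε hucont (by simp [hcenter]) hne
    (by simpa using signs 1 one_ne_zero) (by simpa using signs (-1) (by norm_num))
  exact ⟨σ, hσ, ε, hε, fun s hs => ⟨(branch s hs).1, (branch s hs).2, hsign s hs⟩⟩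


/-! ### The difference of two curves near a crossing. -/

/-- The identification of the plane with the complex numbers. -/
noncomputable def planeToComplex : Plane ≃ₗᵢ[ℝ] ℂ := Complex.orthonormalBasisOneI.repr.symm

/-- The difference of two plane curves, as a complex function of two parameters. -/
noncomputable def curveDifference (γ₁ γ₂ : ℝ → Plane) (s t : ℝ) : ℂ :=
  planeToComplex (γ₁ s) - planeToComplex (γ₂ t)

theorem continuous_curveDifference {γ₁ γ₂ : ℝ → Plane} (h₁ : Continuous γ₁) (h₂ : Continuous γ₂) :
    Continuous (Function.uncurry (curveDifference γ₁ γ₂)) := by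
  have := planeToComplex.continuous
  exact (this.comp (h₁.comp continuous_fst)).sub (this.comp (h₂.comp continuous_snd))

theorem curveDifference_eq_zero {γ₁ γ₂ : ℝ → Plane} {s t : ℝ} :
    curveDifference γ₁ γ₂ s t = 0 ↔ γ₁ s = γ₂ t := by
  rw [curveDifference, sub_eq_zero, planeToComplex.injective.eq_iff]

theorem windingChange_congr {F F' : ℝ → ℝ → ℂ} {a b c d : ℝ} (hab : a ≤ b) (hcd : c ≤ d)
    (h : ∀ s ∈ Icc a b, ∀ t ∈ Icc c d, F s t = F' s t) :
    windingChange F a b c d = windingChange F' a b c d := by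
  have hc := left_mem_Icc.2 hcd
  have hb := right_mem_Icc.2 hab
  have hd := right_mem_Icc.2 hcd
  have ha := left_mem_Icc.2 hab
  unfold windingChange
  rw [logChange_congr fun s hs => h s hs c hc, logChange_congr fun t ht => h b hb t ht,
    logChange_congr fun s hs => h s hs d hd, logChange_congr fun t ht => h a ha t ht]

/-- If two curves run along the two axes of a local coordinate system and change sides at its
centre, then their difference has odd winding number around the crossing. -/
theorem isLocallyOdd_of_chart {γ₁ γ₂ : ℝ → Plane} (hγ₁ : Continuous γ₁) (hγ₂ : Continuous γ₂)
    (h : OpenPartialHomeomorph Plane (ℝ × ℝ)) {s₀ t₀ ε σ ρ : ℝ} (hε : 0 < ε)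
    (hσ : |σ| = 1) (hρ : |ρ| = 1) (h₁ : h (γ₁ s₀) = 0) (h₂ : h (γ₂ t₀) = 0)
    (hs : ∀ s ∈ Ioo (s₀ - ε) (s₀ + ε), γ₁ s ∈ h.source ∧ (h (γ₁ s)).2 = 0 ∧
      (s ≠ s₀ → 0 < σ * (h (γ₁ s)).1 * (s - s₀)))
    (ht : ∀ t ∈ Ioo (t₀ - ε) (t₀ + ε), γ₂ t ∈ h.source ∧ (h (γ₂ t)).1 = 0 ∧
      (t ≠ t₀ → 0 < ρ * (h (γ₂ t)).2 * (t - t₀))) :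
    IsLocallyOdd (curveDifference γ₁ γ₂) (s₀, t₀) := by
  intro η hη
  have hs₀ : s₀ ∈ Ioo (s₀ - ε) (s₀ + ε) := ⟨by linarith, by linarith⟩
  have ht₀ : t₀ ∈ Ioo (t₀ - ε) (t₀ + ε) := ⟨by linarith, by linarith⟩
  have htarget : (0 : ℝ × ℝ) ∈ h.target := h₁ ▸ h.map_source (hs s₀ hs₀).1
  obtain ⟨r, hr, hball⟩ := Metric.isOpen_iff.1 h.open_target 0 htarget
  have box : ∀ x y : ℝ, |x| < r → |y| < r → (x, y) ∈ h.target := fun x y hx hy =>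
    hball (by simpa [Prod.dist_eq] using ⟨hx, hy⟩)
  set u : ℝ → ℝ := fun s => (h (γ₁ s)).1 with hu
  set v : ℝ → ℝ := fun t => (h (γ₂ t)).2 with hv
  have ucont : ContinuousOn u (Ioo (s₀ - ε) (s₀ + ε)) :=
    continuous_fst.comp_continuousOn
      (h.continuousOn.comp hγ₁.continuousOn fun s hs' => (hs s hs').1)
  have vcont : ContinuousOn v (Ioo (t₀ - ε) (t₀ + ε)) :=
    continuous_snd.comp_continuousOn
      (h.continuousOn.comp hγ₂.continuousOn fun t ht' => (ht t ht').1)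
  have usmall : ∀ᶠ s in 𝓝 s₀, |u s| < r := by
    refine ((ucont.continuousAt (Ioo_mem_nhds hs₀.1 hs₀.2)).abs).eventually_lt_const ?_
    simpa [hu, h₁] using hr
  have vsmall : ∀ᶠ t in 𝓝 t₀, |v t| < r := by
    refine ((vcont.continuousAt (Ioo_mem_nhds ht₀.1 ht₀.2)).abs).eventually_lt_const ?_
    simpa [hv, h₂] using hr
  obtain ⟨ε₁, hε₁, hu₁⟩ := Metric.eventually_nhds_iff_ball.1 usmall
  obtain ⟨ε₂, hε₂, hv₂⟩ := Metric.eventually_nhds_iff_ball.1 vsmall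
  rw [Real.ball_eq_Ioo] at hu₁ hv₂
  obtain ⟨δ, hδ, hδlt⟩ := exists_between
    (show 0 < min (min η ε) (min r (min ε₁ ε₂)) by simp [hη, hε, hr, hε₁, hε₂])
  simp only [lt_min_iff] at hδlt
  obtain ⟨⟨hδη, hδε⟩, hδr, hδ₁, hδ₂⟩ := hδlt
  refine ⟨δ, hδ, hδη, ?_⟩
  have sub_s : Icc (s₀ - δ) (s₀ + δ) ⊆ Ioo (s₀ - ε) (s₀ + ε) :=
    Icc_subset_Ioo (by linarith) (by linarith)
  have sub_t : Icc (t₀ - δ) (t₀ + δ) ⊆ Ioo (t₀ - ε) (t₀ + ε) :=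
    Icc_subset_Ioo (by linarith) (by linarith)
  have ubd : ∀ s ∈ Icc (s₀ - δ) (s₀ + δ), |u s| < r := fun s hs =>
    hu₁ s ⟨by linarith [hs.1], by linarith [hs.2]⟩
  have vbd : ∀ t ∈ Icc (t₀ - δ) (t₀ + δ), |v t| < r := fun t ht =>
    hv₂ t ⟨by linarith [ht.1], by linarith [ht.2]⟩
  have lin_s : ∀ s ∈ Icc (s₀ - δ) (s₀ + δ), |σ * (s - s₀)| < r := fun s hs => by
    rw [abs_mul, hσ, one_mul, abs_lt]
    exact ⟨by linarith [hs.1], by linarith [hs.2]⟩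
  have lin_t : ∀ t ∈ Icc (t₀ - δ) (t₀ + δ), |ρ * (t - t₀)| < r := fun t ht => by
    rw [abs_mul, hρ, one_mul, abs_lt]
    exact ⟨by linarith [ht.1], by linarith [ht.2]⟩
  have shrink : ∀ τ ∈ Icc (0 : ℝ) 1, ∀ x, |x| < r → |(-τ) * x| < r := fun τ hτ x hx => by
    rw [abs_mul, abs_neg, abs_of_nonneg hτ.1]
    nlinarith [hτ.2, abs_nonneg x]
  have combine : ∀ τ ∈ Icc (0 : ℝ) 1, ∀ x y, |x| < r → |y| < r →
      |(1 - τ) * x + τ * y| < r := fun τ hτ x y hx hy => by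
    rw [abs_lt] at hx hy ⊢
    have h1 : 0 ≤ 1 - τ := sub_nonneg.2 hτ.2
    have h2 := hτ.1
    constructor
    · by_contra hneg
      nlinarith [mul_nonneg h1 (show 0 ≤ x + r by linarith),
        mul_nonneg h2 (show 0 ≤ y + r by linarith)]
    · by_contra hneg
      nlinarith [mul_nonneg h1 (show 0 ≤ r - x by linarith),
        mul_nonneg h2 (show 0 ≤ r - y by linarith)]
  -- In the chart the curves are $(u(s),0)$ and $(0,v(t))$, the values of `P` and `Q` at $\tau=0$.
  -- At $\tau=1$ one has $P=-Q$, both linear in $(s-s_0,t-t_0)$, so point reflection exchanges `P`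
  -- and `Q` and the difference of their images in the plane is odd, whatever the chart is.
  let P : ℝ × ℝ × ℝ → ℝ × ℝ := fun p =>
    ((1 - p.1) * u p.2.1 + p.1 * (σ * (p.2.1 - s₀)), (-p.1) * (ρ * (p.2.2 - t₀)))
  let Q : ℝ × ℝ × ℝ → ℝ × ℝ := fun p =>
    ((-p.1) * (σ * (p.2.1 - s₀)), (1 - p.1) * v p.2.2 + p.1 * (ρ * (p.2.2 - t₀)))
  let D : Set (ℝ × ℝ × ℝ) := Icc 0 1 ×ˢ Icc (s₀ - δ) (s₀ + δ) ×ˢ Icc (t₀ - δ) (t₀ + δ)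
  have uD : ContinuousOn (fun p : ℝ × ℝ × ℝ => u p.2.1) D :=
    ucont.comp (by fun_prop) fun p hp => sub_s hp.2.1
  have vD : ContinuousOn (fun p : ℝ × ℝ × ℝ => v p.2.2) D :=
    vcont.comp (by fun_prop) fun p hp => sub_t hp.2.2
  have one_sub : ContinuousOn (fun p : ℝ × ℝ × ℝ => 1 - p.1) D := by fun_prop
  have Pcont : ContinuousOn P D :=
    ((one_sub.mul uD).add (g := fun p => p.1 * (σ * (p.2.1 - s₀))) (by fun_prop)).prodMk
      (g := fun p => (-p.1) * (ρ * (p.2.2 - t₀))) (by fun_prop)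
  have Qcont : ContinuousOn Q D :=
    ContinuousOn.prodMk (f := fun p => (-p.1) * (σ * (p.2.1 - s₀))) (by fun_prop)
      ((one_sub.mul vD).add (g := fun p => p.1 * (ρ * (p.2.2 - t₀))) (by fun_prop))
  have Pmem : MapsTo P D h.target := fun p hp =>
    box _ _ (combine _ hp.1 _ _ (ubd _ hp.2.1) (lin_s _ hp.2.1)) (shrink _ hp.1 _ (lin_t _ hp.2.2))
  have Qmem : MapsTo Q D h.target := fun p hp =>
    box _ _ (shrink _ hp.1 _ (lin_s _ hp.2.1)) (combine _ hp.1 _ _ (vbd _ hp.2.2) (lin_t _ hp.2.2))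
  let K : ℝ → ℝ → ℝ → ℂ := fun τ s t =>
    planeToComplex (h.symm (P (τ, s, t))) - planeToComplex (h.symm (Q (τ, s, t)))
  have Kcont : ContinuousOn (fun p : ℝ × ℝ × ℝ => K p.1 p.2.1 p.2.2) D :=
    (planeToComplex.continuous.comp_continuousOn (h.symm.continuousOn.comp Pcont Pmem)).sub
      (planeToComplex.continuous.comp_continuousOn (h.symm.continuousOn.comp Qcont Qmem))
  -- Here $x$ and $az$ have the same sign. So the left side has that sign, while the right side is
  -- zero or of the opposite sign.
  have sign : ∀ τ ∈ Icc (0 : ℝ) 1, ∀ a x z : ℝ, 0 < a * x * z →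
      (1 - τ) * x + τ * (a * z) ≠ (-τ) * (a * z) := by
    intro τ hτ a x z hpos heq
    have h1 : ((1 - τ) * x + 2 * τ * (a * z)) * (a * z) = 0 := by linear_combination (a * z) * heq
    have h2 : 0 ≤ (1 - τ) * (a * x * z) := mul_nonneg (sub_nonneg.2 hτ.2) hpos.le
    have h3 : 0 < (a * z) ^ 2 := by
      have : a * z ≠ 0 := by
        rintro h0
        rw [show a * x * z = x * (a * z) by ring, h0, mul_zero] at hpos
        exact lt_irrefl _ hpos
      positivity
    rcases hτ.1.eq_or_lt with h4 | h4
    · rw [← h4] at h1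
      linarith
    · nlinarith [mul_pos h4 h3]
  have Kne : ∀ τ ∈ Icc (0 : ℝ) 1, ∀ s ∈ Icc (s₀ - δ) (s₀ + δ), ∀ t ∈ Icc (t₀ - δ) (t₀ + δ),
      (s = s₀ - δ ∨ s = s₀ + δ ∨ t = t₀ - δ ∨ t = t₀ + δ) → K τ s t ≠ 0 := by
    intro τ hτ s hs' t ht' hst hzero
    have hD : (τ, s, t) ∈ D := ⟨hτ, hs', ht'⟩
    have heq : P (τ, s, t) = Q (τ, s, t) :=
      h.symm.injOn (Pmem hD) (Qmem hD) (planeToComplex.injective (sub_eq_zero.1 hzero))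
    have hst' : s ≠ s₀ ∨ t ≠ t₀ := by
      rcases hst with h | h | h | h
      · exact .inl (by linarith)
      · exact .inl (by linarith)
      · exact .inr (by linarith)
      · exact .inr (by linarith)
    rcases hst' with h3 | h3
    · exact sign τ hτ _ _ _ ((hs s (sub_s hs')).2.2 h3) (congrArg Prod.fst heq)
    · exact sign τ hτ _ _ _ ((ht t (sub_t ht')).2.2 h3) (congrArg Prod.snd heq).symm
  have hleS : s₀ - δ ≤ s₀ + δ := by linarith
  have hleT : t₀ - δ ≤ t₀ + δ := by linarith
  have start : windingChange (curveDifference γ₁ γ₂) (s₀ - δ) (s₀ + δ) (t₀ - δ) (t₀ + δ) =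
      windingChange (K 0) (s₀ - δ) (s₀ + δ) (t₀ - δ) (t₀ + δ) := by
    refine windingChange_congr hleS hleT fun s hs' t ht' => ?_
    obtain ⟨h3, h4, -⟩ := hs s (sub_s hs')
    obtain ⟨h5, h6, -⟩ := ht t (sub_t ht')
    have hP : P (0, s, t) = h (γ₁ s) := by
      apply Prod.ext
      · simp [P, u]
      · simp [P, h4]
    have hQ : Q (0, s, t) = h (γ₂ t) := by
      apply Prod.ext
      · simp [Q, h6]
      · simp [Q, v]
    simp only [K, hP, hQ, h.left_inv h3, h.left_inv h5, curveDifference]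
  change ∃ k : ℤ, windingChange (curveDifference γ₁ γ₂) (s₀ - δ) (s₀ + δ) (t₀ - δ) (t₀ + δ) = _
  rw [start, windingChange_homotopy hleS hleT Kcont Kne]
  refine windingChange_of_odd hleS hleT
    (Kcont.comp (f := fun p : ℝ × ℝ => (1, p.1, p.2)) (by fun_prop)
      fun p hp => ⟨⟨zero_le_one, le_rfl⟩, hp.1, hp.2⟩)
    (Kne 1 ⟨zero_le_one, le_rfl⟩) fun s _ t _ => ?_
  have hPQ : P (1, s₀ - δ + (s₀ + δ) - s, t₀ - δ + (t₀ + δ) - t) = Q (1, s, t) := by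
    apply Prod.ext <;> simp only [P, Q] <;> ring
  have hQP : Q (1, s₀ - δ + (s₀ + δ) - s, t₀ - δ + (t₀ + δ) - t) = P (1, s, t) := by
    apply Prod.ext <;> simp only [P, Q] <;> ring
  simp only [K, hPQ, hQP, neg_sub]

/-! ### Crossings of two disjoint edges. -/

section DisjointEdges

variable {V : Type*} [Fintype V] [DecidableEq V] {G : SimpleGraph V} {f : realization G → Plane}
  {v w v' w' : V}

theorem edgePath_ne_of_disjoint (h : G.Adj v w) (h' : G.Adj v' w')
    (hd : ∀ u, u ∈ s(v, w) → u ∉ s(v', w')) (s t : ℝ) : edgePath h s ≠ edgePath h' t :=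
  fun heq => closedEdge_disjoint hd (edgePath_mem_closedEdge h s)
    (heq ▸ edgePath_mem_closedEdge h' t)

/-- This keeps the zeros of the difference map off the boundary of the parameter square. -/
theorem mem_Ioo_of_double (hf : IsGenericImmersion G f) (h : G.Adj v w) {s : ℝ}
    (hs : s ∈ Icc (0 : ℝ) 1) {b : realization G} (hne : edgePath h s ≠ b)
    (heq : f (edgePath h s) = f b) : s ∈ Ioo (0 : ℝ) 1 := by
  obtain ⟨e, he, hmem⟩ := hf.interior _ _ hne heq
  refine ⟨lt_of_le_of_ne hs.1 ?_, lt_of_le_of_ne hs.2 ?_⟩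
  · rintro rfl
    rw [edgePath_zero] at hmem
    exact vertexPoint_notMem_openEdge v he hmem
  · rintro rfl
    rw [edgePath_one] at hmem
    exact vertexPoint_notMem_openEdge w he hmem

theorem isLocallyOdd_of_double (hf : IsGenericImmersion G f) (h : G.Adj v w) (h' : G.Adj v' w')
    {s t : ℝ} (hs : s ∈ Icc (0 : ℝ) 1) (ht : t ∈ Icc (0 : ℝ) 1)
    (hne : edgePath h s ≠ edgePath h' t) (heq : f (edgePath h s) = f (edgePath h' t)) :
    IsLocallyOdd (curveDifference (fun s => f (edgePath h s)) fun t => f (edgePath h' t))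
      (s, t) := by
  obtain ⟨φ, ⟨ha, ha0⟩, ⟨hb, hb0⟩, ⟨A, hA, hfA⟩, ⟨B, hB, hfB⟩⟩ := hf.transversal _ _ hne heq
  obtain ⟨σ, hσ, ε₁, hε₁, h1⟩ := exists_branch_sign hf h (mem_Ioo_of_double hf h hs hne heq) hne heq
    φ ha ha0 hA hB hfA hfB
  -- Exchanging the coordinates turns the second branch into the horizontal one, so the same lemma
  -- applies to it.
  let ψ : OpenPartialHomeomorph Plane (ℝ × ℝ) :=
    φ.transHomeomorph (Homeomorph.prodComm ℝ ℝ)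
  obtain ⟨ρ, hρ, ε₂, hε₂, h2⟩ := exists_branch_sign hf h'
    (mem_Ioo_of_double hf h' ht hne.symm heq.symm) hne.symm heq.symm
    ψ hb (by simp [ψ, hb0]) hB hA (by simpa [ψ] using hfB) (by simpa [ψ] using hfA)
  refine isLocallyOdd_of_chart (hf.continuous.comp (continuous_edgePath h))
    (hf.continuous.comp (continuous_edgePath h')) φ (lt_min hε₁ hε₂) hσ hρ ha0 hb0
    (fun s' hs' => h1 s' ⟨?_, ?_⟩) fun t' ht' => ?_
  · linarith [hs'.1, min_le_left ε₁ ε₂]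
  · linarith [hs'.2, min_le_left ε₁ ε₂]
  · simpa [ψ] using h2 t' ⟨by linarith [ht'.1, min_le_right ε₁ ε₂],
      by linarith [ht'.2, min_le_right ε₁ ε₂]⟩

/-- The number of crossing points of two disjoint edges has the parity of the winding number of
the difference map along the boundary of the parameter square. -/
theorem windingChange_disjoint_edges (hf : IsGenericImmersion G f) (h : G.Adj v w)
    (h' : G.Adj v' w') (hd : ∀ u, u ∈ s(v, w) → u ∉ s(v', w')) :
    ∃ k : ℤ, windingChange
        (curveDifference (fun s => f (edgePath h s)) fun t => f (edgePath h' t)) 0 1 0 1 =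
      2 * Real.pi * Complex.I * ((crossingPoints f ∩
        (edgeImage f s(v, w) ∩ edgeImage f s(v', w'))).ncard + 2 * k) := by
  set F := curveDifference (fun s => f (edgePath h s)) fun t => f (edgePath h' t) with hF
  have disj := edgePath_ne_of_disjoint h h' hd
  let Z : Set (ℝ × ℝ) := {p | (p.1 ∈ Icc 0 1 ∧ p.2 ∈ Icc 0 1) ∧ F p.1 p.2 = 0}
  have hZ : ∀ p ∈ Z, f (edgePath h p.1) = f (edgePath h' p.2) := fun p hp =>
    curveDifference_eq_zero.1 hp.2
  -- There are no triple points, so a zero is determined by its image in the plane. This gives both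
  -- the count of crossings and distinct first coordinates of the zeros.
  have hinj : ∀ p ∈ Z, ∀ q ∈ Z, f (edgePath h p.1) = f (edgePath h q.1) → p = q := by
    intro p hp q hq heq
    apply Prod.ext
    · rcases hf.double _ _ _ heq (hZ q hq) with h1 | h1 | h1
      · exact injOn_edgePath h hp.1.1 hq.1.1 h1
      · exact absurd h1 (disj _ _)
      · exact absurd h1 (disj _ _)
    · rcases hf.double _ _ _ (heq.symm.trans (hZ p hp)) ((hZ p hp).symm.trans (heq.trans (hZ q hq)))
        with h1 | h1 | h1
      · exact absurd h1 (disj _ _)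
      · exact injOn_edgePath h' hp.1.2 hq.1.2 h1
      · exact absurd h1 (disj _ _)
  have himage : (fun p : ℝ × ℝ => f (edgePath h p.1)) '' Z =
      crossingPoints f ∩ (edgeImage f s(v, w) ∩ edgeImage f s(v', w')) := by
    ext x
    constructor
    · rintro ⟨p, hp, rfl⟩
      exact ⟨⟨_, _, disj p.1 p.2, rfl, (hZ p hp).symm⟩, ⟨_, edgePath_mem_closedEdge h _, rfl⟩,
        ⟨_, edgePath_mem_closedEdge h' _, (hZ p hp).symm⟩⟩
    · rintro ⟨-, ⟨a, ha, rfl⟩, b, hb, hab⟩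
      obtain ⟨h1, h2⟩ := eq_edgePath_of_mem_closedEdge h ha
      obtain ⟨h3, h4⟩ := eq_edgePath_of_mem_closedEdge h' hb
      refine ⟨((a : V → ℝ) w, (b : V → ℝ) w'), ⟨⟨h1, h3⟩, curveDifference_eq_zero.2 ?_⟩, ?_⟩
      · simp only
        rw [← h2, ← h4, hab]
      · simp only
        rw [← h2]
  have hinjOn : InjOn (fun p : ℝ × ℝ => f (edgePath h p.1)) Z := fun p hp q hq => hinj p hp q hq
  have hfin : Z.Finite := by
    refine Finite.of_finite_image ?_ hinjOn
    rw [himage]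
    exact hf.finite.inter_of_left _
  obtain ⟨k, hk⟩ := windingChange_parity zero_le_one
    (continuous_curveDifference (hf.continuous.comp (continuous_edgePath h))
      (hf.continuous.comp (continuous_edgePath h'))) hfin.toFinset.card zero_le_one
    (Z := hfin.toFinset) (fun p => hfin.mem_toFinset)
    (fun p hp => by
      rw [hfin.mem_toFinset] at hp
      exact ⟨mem_Ioo_of_double hf h hp.1.1 (disj _ _) (hZ p hp),
        mem_Ioo_of_double hf h' hp.1.2 (disj _ _).symm (hZ p hp).symm⟩)
    (fun p hp q hq heq => by
      rw [hfin.mem_toFinset] at hp hq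
      exact hinj p hp q hq (by rw [heq]))
    (fun p hp => by
      rw [hfin.mem_toFinset] at hp
      exact isLocallyOdd_of_double hf h h' hp.1.1 hp.1.2 (disj _ _) (hZ p hp)) rfl
  refine ⟨k, ?_⟩
  rw [← himage, hinjOn.ncard_image, ncard_eq_toFinset_card Z hfin]
  exact hk

end DisjointEdges


/-! ### Reduction to a chord drawing modulo two. -/

section Parity

/-- The sign recording which of two vertices has the smaller rank. -/
def rankSign {V : Type*} (r : V → ℕ) (v w : V) : ℤ := if r v < r w then 1 else -1

/-- The winding number of the difference map of two disjoint edges which are drawn as chords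
between points in convex position, ordered by rank. -/
def chordWinding {V : Type*} (r : V → ℕ) (v w v' w' : V) : ℤ :=
  (rankSign r v v' - rankSign r w v' + rankSign r w w' - rankSign r v w') / 2

theorem two_mul_chordWinding {V : Type*} (r : V → ℕ) (v w v' w' : V) :
    2 * chordWinding r v w v' w' =
      rankSign r v v' - rankSign r w v' + rankSign r w w' - rankSign r v w' := by
  unfold chordWinding rankSign
  split_ifs <;> norm_num

variable {V : Type*} [Fintype V] [DecidableEq V] {G : SimpleGraph V} {f : realization G → Plane}

theorem injective_vertex_image (hf : IsGenericImmersion G f) :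
    Function.Injective fun v => f (vertexPoint G v) := by
  intro v w h
  by_contra hne
  have hne' : vertexPoint G v ≠ vertexPoint G w := fun heq => by
    have := congrFun (congrArg Subtype.val heq) v
    simp [vertexPoint, hne] at this
  obtain ⟨e, he, hmem⟩ := hf.interior _ _ hne' h
  exact vertexPoint_notMem_openEdge v he hmem

theorem vertexPoint_ne_edgePath {u v w : V} (h : G.Adj v w) (huv : u ≠ v) (huw : u ≠ w) (s : ℝ) :
    edgePath h s ≠ vertexPoint G u := by
  intro heq
  have := (edgePath_mem_closedEdge h s).2 u (by simp [huv, huw])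
  simp [heq, vertexPoint] at this

theorem edgePath_image_ne_vertex (hf : IsGenericImmersion G f) {u v w : V} (h : G.Adj v w)
    (huv : u ≠ v) (huw : u ≠ w) (s : ℝ) : f (edgePath h s) ≠ f (vertexPoint G u) := by
  intro heq
  obtain ⟨e, he, hmem⟩ := hf.interior _ _ (vertexPoint_ne_edgePath h huv huw s).symm heq.symm
  exact vertexPoint_notMem_openEdge u he hmem

/-- The image of a vertex as a complex number. -/
noncomputable def vertexImage (f : realization G → Plane) (v : V) : ℂ :=
  planeToComplex (f (vertexPoint G v))

/-- A logarithm of the difference of the images of two vertices. The choices for the two orders of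
the vertices differ by `πi`. -/
noncomputable def vertexLog (f : realization G → Plane) (r : V → ℕ) (v w : V) : ℂ :=
  if r v < r w then Complex.log (vertexImage f v - vertexImage f w)
  else Complex.log (vertexImage f w - vertexImage f v) + Real.pi * Complex.I

theorem exp_vertexLog (hf : IsGenericImmersion G f) (r : V → ℕ) {v w : V} (hvw : v ≠ w) :
    Complex.exp (vertexLog f r v w) = vertexImage f v - vertexImage f w := by
  have hne : vertexImage f v ≠ vertexImage f w := fun h =>
    hvw (injective_vertex_image hf (planeToComplex.injective h))
  unfold vertexLog
  split_ifs
  · exact Complex.exp_log (sub_ne_zero.2 hne)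
  · rw [Complex.exp_add, Complex.exp_log (sub_ne_zero.2 hne.symm), Complex.exp_pi_mul_I]
    ring

theorem vertexLog_swap {r : V → ℕ} (hr : Function.Injective r) {v w : V} (hvw : v ≠ w) :
    vertexLog f r w v - vertexLog f r v w = Real.pi * Complex.I * rankSign r v w := by
  unfold vertexLog rankSign
  rcases lt_trichotomy (r v) (r w) with h | h | h
  · simp [h, h.not_gt]
  · exact absurd (hr h) hvw
  · simp [h, h.not_gt]

/-- The exponentials of both sides agree, since the edge runs from `v` to `w` and its image misses
that of `u`. The integer `n u v w` measures how the edge winds around `u` relative to the chosen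
vertex logarithms. -/
theorem exists_edge_winding (hf : IsGenericImmersion G f) (r : V → ℕ) :
    ∃ n : V → V → V → ℤ, ∀ (u v w : V) (h : G.Adj v w), u ≠ v → u ≠ w →
      logChange (fun s => planeToComplex (f (edgePath h s)) - vertexImage f u) 0 1 =
        vertexLog f r w u - vertexLog f r v u + 2 * Real.pi * Complex.I * n u v w := by
  have : ∀ u v w : V, ∃ n : ℤ, ∀ h : G.Adj v w, u ≠ v → u ≠ w →
      logChange (fun s => planeToComplex (f (edgePath h s)) - vertexImage f u) 0 1 =
        vertexLog f r w u - vertexLog f r v u + 2 * Real.pi * Complex.I * n := by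
    intro u v w
    by_cases hyp : G.Adj v w ∧ u ≠ v ∧ u ≠ w
    · obtain ⟨h, huv, huw⟩ := hyp
      have hexp := exp_logChange (c := fun s => planeToComplex (f (edgePath h s)) - vertexImage f u)
        zero_le_one ((planeToComplex.continuous.comp
          (hf.continuous.comp (continuous_edgePath h))).sub continuous_const).continuousOn
        fun s _ => sub_ne_zero.2 fun heq =>
          edgePath_image_ne_vertex hf h huv huw s (planeToComplex.injective heq)
      rw [edgePath_zero, edgePath_one] at hexp
      change _ = (vertexImage f w - _) / (vertexImage f v - _) at hexp
      rw [← exp_vertexLog hf r huw.symm, ← exp_vertexLog hf r huv.symm, ← Complex.exp_sub,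
        Complex.exp_eq_exp_iff_exists_int] at hexp
      obtain ⟨n, hn⟩ := hexp
      exact ⟨n, fun _ _ _ => by rw [hn]; ring⟩
    · exact ⟨0, fun h h1 h2 => absurd ⟨h, h1, h2⟩ hyp⟩
  choose n hn using this
  exact ⟨n, fun u v w => hn u v w⟩

/-- Each side of the parameter square gives one edge seen from one vertex. The vertex logarithms
then pair up into swaps, each worth $\pm\pi i$, and these add up to `chordWinding`. -/
theorem ncard_crossings_parity (hf : IsGenericImmersion G f) {r : V → ℕ}
    (hr : Function.Injective r) {n : V → V → V → ℤ}
    (hn : ∀ (u v w : V) (h : G.Adj v w), u ≠ v → u ≠ w →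
      logChange (fun s => planeToComplex (f (edgePath h s)) - vertexImage f u) 0 1 =
        vertexLog f r w u - vertexLog f r v u + 2 * Real.pi * Complex.I * n u v w)
    {v w v' w' : V} (h : G.Adj v w) (h' : G.Adj v' w') (h1 : v ≠ v') (h2 : v ≠ w') (h3 : w ≠ v')
    (h4 : w ≠ w') :
    ∃ k : ℤ, ((crossingPoints f ∩ (edgeImage f s(v, w) ∩ edgeImage f s(v', w'))).ncard : ℤ) =
      n v' v w + n w' v w + n v v' w' + n w v' w' + chordWinding r v w v' w' + 2 * k := by
  obtain ⟨k, hk⟩ := windingChange_disjoint_edges hf h h' (by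
    intro u hu
    rw [Sym2.mem_iff] at hu ⊢
    rcases hu with rfl | rfl
    · tauto
    · tauto)
  have flip : ∀ u, u ≠ v' → u ≠ w' →
      logChange (fun t => vertexImage f u - planeToComplex (f (edgePath h' t))) 0 1 =
      logChange (fun t => planeToComplex (f (edgePath h' t)) - vertexImage f u) 0 1 := by
    intro u hu hu'
    rw [← logChange_neg (c := fun t => planeToComplex (f (edgePath h' t)) - vertexImage f u)
      zero_le_one ((planeToComplex.continuous.comp
        (hf.continuous.comp (continuous_edgePath h'))).sub continuous_const).continuousOn
      fun s _ => sub_ne_zero.2 fun heq =>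
        edgePath_image_ne_vertex hf h' hu hu' s (planeToComplex.injective heq)]
    simp only [neg_sub]
  simp only [windingChange, curveDifference, edgePath_zero, edgePath_one] at hk
  change logChange (fun s => planeToComplex (f (edgePath h s)) - vertexImage f v') 0 1 +
    logChange (fun t => vertexImage f w - planeToComplex (f (edgePath h' t))) 0 1 -
    logChange (fun s => planeToComplex (f (edgePath h s)) - vertexImage f w') 0 1 -
    logChange (fun t => vertexImage f v - planeToComplex (f (edgePath h' t))) 0 1 = _ at hk
  rw [flip w h3 h4, flip v h1 h2, hn v' v w h h1.symm h3.symm, hn w' v w h h2.symm h4.symm,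
    hn v v' w' h' h1 h2, hn w v' w' h' h3 h4] at hk
  have e1 := vertexLog_swap (f := f) hr h1
  have e2 := vertexLog_swap (f := f) hr h2
  have e3 := vertexLog_swap (f := f) hr h3
  have e4 := vertexLog_swap (f := f) hr h4
  have hc : (2 * chordWinding r v w v' w' : ℂ) =
      rankSign r v v' - rankSign r w v' + rankSign r w w' - rankSign r v w' := by
    exact_mod_cast congrArg (Int.cast (R := ℂ)) (two_mul_chordWinding r v w v' w')
  have hpi : (2 * Real.pi * Complex.I : ℂ) ≠ 0 := Complex.two_pi_I_ne_zero
  -- The top and left sides enter the winding number with a minus sign; modulo two the sign is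
  -- dropped, at the cost of this even correction.
  refine ⟨-(n w' v w + n v v' w') - k, ?_⟩
  have key : (2 * Real.pi * Complex.I : ℂ) *
      ((crossingPoints f ∩ (edgeImage f s(v, w) ∩ edgeImage f s(v', w'))).ncard + 2 * k) =
      (2 * Real.pi * Complex.I : ℂ) *
      (n v' v w + n w v' w' - n w' v w - n v v' w' + chordWinding r v w v' w') := by
    linear_combination -hk + e1 - e2 - e3 + e4 - Real.pi * Complex.I * hc
  have key' := mul_left_cancel₀ hpi key
  have key'' : ((crossingPoints f ∩ (edgeImage f s(v, w) ∩ edgeImage f s(v', w'))).ncard + 2 * k : ℤ)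
      = n v' v w + n w v' w' - n w' v w - n v v' w' + chordWinding r v w v' w' := by
    exact_mod_cast key'
  linarith

/-- The pair of edges `{v, w}`, `{v', w'}` given by the quadruple `(v, w, v', w')`. -/
def edgePair (q : V × V × V × V) : Sym2 (Sym2 V) := s(s(q.1, q.2.1), s(q.2.2.1, q.2.2.2))

/-- The quadruple `(v, w, v', w')` spans two disjoint edges of `G`. -/
def IsDisjointQuad (G : SimpleGraph V) (q : V × V × V × V) : Prop :=
  (G.Adj q.1 q.2.1 ∧ G.Adj q.2.2.1 q.2.2.2) ∧ (q.1 ≠ q.2.2.1 ∧ q.1 ≠ q.2.2.2) ∧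
    (q.2.1 ≠ q.2.2.1 ∧ q.2.1 ≠ q.2.2.2)

instance [DecidableRel G.Adj] : DecidablePred (IsDisjointQuad G) := fun q => by
  unfold IsDisjointQuad
  infer_instance

theorem disjointEdgePairs_eq {T : List (V × V × V × V)} (hT : ∀ q ∈ T, IsDisjointQuad G q)
    (hcomplete : ∀ q, IsDisjointQuad G q → edgePair q ∈ T.map edgePair) :
    disjointEdgePairs G = (T.map edgePair).toFinset := by
  ext z
  rw [disjointEdgePairs, Finite.mem_toFinset, List.mem_toFinset]
  constructor
  · rintro ⟨x, hx, y, hy, hxy, rfl⟩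
    induction x using Sym2.ind with
    | _ v w =>
      induction y using Sym2.ind with
      | _ v' w' =>
        have h1 := hxy v (by simp)
        have h2 := hxy w (by simp)
        simp only [Sym2.mem_iff, not_or] at h1 h2
        exact hcomplete (v, w, v', w') ⟨⟨hx, hy⟩, h1, h2⟩
  · intro hz
    obtain ⟨⟨v, w, v', w'⟩, hq, rfl⟩ := List.mem_map.1 hz
    obtain ⟨⟨h1, h2⟩, h3, h4⟩ := hT _ hq
    refine ⟨s(v, w), h1, s(v', w'), h2, fun u hu => ?_, rfl⟩
    simp only [Sym2.mem_iff, not_or] at hu ⊢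
    rcases hu with rfl | rfl
    · exact h3
    · exact h4

/-- The parity of `d f` is that of the corresponding number for a drawing by chords, if in the list
of all pairs of disjoint edges the contributions of the edge windings cancel modulo two. -/
theorem d_parity (hf : IsGenericImmersion G f) {r : V → ℕ} (hr : Function.Injective r)
    {T : List (V × V × V × V)} (hT : ∀ q ∈ T, IsDisjointQuad G q)
    (hcomplete : ∀ q, IsDisjointQuad G q → edgePair q ∈ T.map edgePair)
    (hnodup : (T.map edgePair).Nodup)
    (hcancel : ∀ n : V → V → V → ℤ, 2 ∣ (T.map fun q => n q.2.2.1 q.1 q.2.1 +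
      n q.2.2.2 q.1 q.2.1 + n q.1 q.2.2.1 q.2.2.2 + n q.2.1 q.2.2.1 q.2.2.2).sum) :
    ∃ k : ℤ, (d f : ℤ) =
      (T.map fun q => chordWinding r q.1 q.2.1 q.2.2.1 q.2.2.2).sum + 2 * k := by
  obtain ⟨n, hn⟩ := exists_edge_winding hf r
  have hsum : (d f : ℤ) = (T.map fun q => ((crossingPoints f ∩
      (edgeImage f s(q.1, q.2.1) ∩ edgeImage f s(q.2.2.1, q.2.2.2))).ncard : ℤ)).sum := by
    rw [d, disjointEdgePairs_eq hT hcomplete, List.sum_toFinset _ hnodup, List.map_map,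
      Nat.cast_list_sum, List.map_map]
    congr 2
    funext q
    simp [edgePair, Function.comp, iInter_or, iInter_inter_distrib]
  have hlist : ∀ S : List (V × V × V × V), (∀ q ∈ S, IsDisjointQuad G q) → ∃ k : ℤ,
      (S.map fun q => ((crossingPoints f ∩
        (edgeImage f s(q.1, q.2.1) ∩ edgeImage f s(q.2.2.1, q.2.2.2))).ncard : ℤ)).sum =
      (S.map fun q => n q.2.2.1 q.1 q.2.1 + n q.2.2.2 q.1 q.2.1 + n q.1 q.2.2.1 q.2.2.2 +
        n q.2.1 q.2.2.1 q.2.2.2).sum +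
      (S.map fun q => chordWinding r q.1 q.2.1 q.2.2.1 q.2.2.2).sum + 2 * k := by
    intro S
    induction S with
    | nil => exact fun _ => ⟨0, by simp⟩
    | cons q S ih =>
      intro hS
      obtain ⟨k, hk⟩ := ih fun p hp => hS p (List.mem_cons_of_mem q hp)
      obtain ⟨⟨h1, h2⟩, ⟨h3, h4⟩, h5, h6⟩ := hS q List.mem_cons_self
      obtain ⟨k', hk'⟩ := ncard_crossings_parity hf hr hn h1 h2 h3 h4 h5 h6
      refine ⟨k + k', ?_⟩
      simp only [List.map_cons, List.sum_cons, hk, hk']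
      ring
  obtain ⟨k, hk⟩ := hlist T hT
  obtain ⟨m, hm⟩ := hcancel n
  exact ⟨m + k, by rw [hsum, hk, hm]; ring⟩

end Parity

/-! ### The two graphs. -/

/-- The pairs of disjoint edges of the complete graph on five vertices. -/
def disjointQuadsK5 : List (Fin 5 × Fin 5 × Fin 5 × Fin 5) :=
  [(0, 1, 2, 3), (0, 2, 1, 3), (0, 3, 1, 2), (0, 1, 2, 4), (0, 2, 1, 4), (0, 4, 1, 2),
    (0, 1, 3, 4), (0, 3, 1, 4), (0, 4, 1, 3), (0, 2, 3, 4), (0, 3, 2, 4), (0, 4, 2, 3),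
    (1, 2, 3, 4), (1, 3, 2, 4), (1, 4, 2, 3)]

/-- The pairs of disjoint edges of the complete bipartite graph on three and three vertices. -/
def disjointQuadsK33 :
    List ((Fin 3 ⊕ Fin 3) × (Fin 3 ⊕ Fin 3) × (Fin 3 ⊕ Fin 3) × (Fin 3 ⊕ Fin 3)) :=
  [(0, 0, 1, 1), (0, 1, 1, 0), (0, 0, 1, 2), (0, 2, 1, 0), (0, 1, 1, 2), (0, 2, 1, 1),
    (0, 0, 2, 1), (0, 1, 2, 0), (0, 0, 2, 2), (0, 2, 2, 0), (0, 1, 2, 2), (0, 2, 2, 1),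
    (1, 0, 2, 1), (1, 1, 2, 0), (1, 0, 2, 2), (1, 2, 2, 0), (1, 1, 2, 2), (1, 2, 2, 1)].map fun p : Fin 3 × Fin 3 × Fin 3 × Fin 3 =>
      (.inl p.1, .inr p.2.1, .inl p.2.2.1, .inr p.2.2.2)

instance {V W : Type*} : DecidableRel (completeBipartiteGraph V W).Adj := fun a b =>
  inferInstanceAs (Decidable (a.isLeft ∧ b.isRight ∨ a.isRight ∧ b.isLeft))

theorem d_completeGraph_odd {f : realization (⊤ : SimpleGraph (Fin 5)) → Plane}
    (hf : IsGenericImmersion ⊤ f) : d f ≡ 1 [MOD 2] := by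
  obtain ⟨k, hk⟩ := d_parity hf (r := Fin.val) Fin.val_injective (T := disjointQuadsK5)
    (by decide +kernel) (by decide +kernel) (by decide +kernel) (fun n => by
      -- Each edge is always listed with the same orientation, so `n u v w` is the same integer at
      -- each occurrence. It occurs twice, once for each of the two vertices outside $u,v,w$.
      simp only [disjointQuadsK5, List.map_cons, List.map_nil, List.sum_cons, List.sum_nil]
      omega)
  -- The five crossings of the diagonals of a convex pentagon.
  have hc : (disjointQuadsK5.map fun q =>
      chordWinding Fin.val q.1 q.2.1 q.2.2.1 q.2.2.2).sum = 5 := by decide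
  rw [hc] at hk
  rw [Nat.ModEq]
  omega

theorem d_completeBipartiteGraph_odd
    {f : realization (completeBipartiteGraph (Fin 3) (Fin 3)) → Plane}
    (hf : IsGenericImmersion (completeBipartiteGraph (Fin 3) (Fin 3)) f) : d f ≡ 1 [MOD 2] := by
  obtain ⟨k, hk⟩ := d_parity hf (r := Sum.elim Fin.val fun i => 3 + i.val) (by decide)
    (T := disjointQuadsK33) (by decide +kernel) (by decide +kernel) (by decide +kernel) (fun n => by
      -- Again each integer occurs twice: `u` has three neighbours, exactly one of which lies on the
      -- edge `vw`.
      simp only [disjointQuadsK33, List.map_cons, List.map_nil, List.sum_cons, List.sum_nil]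
      omega)
  -- The ranks place the two classes in consecutive blocks on a hexagon. The chords from $i<k$ to
  -- $j$ and $l$ cross exactly when $j<l$, which gives $3\cdot 3$ crossings.
  have hc : (disjointQuadsK33.map fun q =>
      chordWinding (Sum.elim Fin.val fun i => 3 + i.val) q.1 q.2.1 q.2.2.1 q.2.2.2).sum = 9 := by
    decide
  rw [hc] at hk
  rw [Nat.ModEq]
  omega

end PlaneGraph

theorem proposition2p1 :
    (∀ f : PlaneGraph.realization (⊤ : SimpleGraph (Fin 5)) → PlaneGraph.Plane,
      PlaneGraph.IsGenericImmersion ⊤ f → PlaneGraph.d f ≡ 1 [MOD 2]) ∧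
    (∀ f : PlaneGraph.realization (completeBipartiteGraph (Fin 3) (Fin 3)) → PlaneGraph.Plane,
      PlaneGraph.IsGenericImmersion (completeBipartiteGraph (Fin 3) (Fin 3)) f →
        PlaneGraph.d f ≡ 1 [MOD 2]) :=
  ⟨fun _ => PlaneGraph.d_completeGraph_odd, fun _ => PlaneGraph.d_completeBipartiteGraph_odd⟩
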